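/- A camera is a matrix $A\in\mathbb{R}^{3\times 4}$ of rank three, and its focus is the point of $\mathbb{P}^3_{\mathbb{R}}$ spanned by the kernel of $A$. Let $\mathcal{A}=(A_1,\dots,A_n)$ be an arrangement of $n\ge 4$ cameras with pairwise distinct foci, and work in the ring $\mathbb{C}[p_1,\dots,p_n]$, where $p_i=(x_i,y_i,z_i)$. Let $M_{\mathcal{A}}$ be the multiview ideal, that is, the ideal of all polynomials that vanish on the set of points $(A_1\mathbf{q},\dots,A_n\mathbf{q})\in(\mathbb{P}^2_{\mathbb{C}})^n$, where $\mathbf{q}$ runs over the points of $\mathbb{P}^3_{\mathbb{R}}$ other than the foci (a polynomial vanishes at a point of $(\mathbb{P}^2_{\mathbb{C}})^n$ if it vanishes at all choices of homogeneous coordinates of the point, scaled independently in each factor). For $2\le k\le n$ and a $k$-element set $\sigma=\{\sigma_1,\dots,\sigma_k\}\subseteq\{1,\dots,n\}$, let $$\mathcal{A}_\sigma(p)=\begin{pmatrix}A_{\sigma_1}&p_{\sigma_1}& & \\ \vdots& &\ddots& \\ A_{\sigma_k}& & &p_{\sigma_k}\end{pmatrix}$$ be the $3k\times(4+k)$ matrix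 in which each $p_{\sigma_i}$ is written as a column and blank entries are zero, and let the $k$-focal ideal $H^k_{\mathcal{A}}$ be the ideal generated by the $(4+k)\times(4+k)$ minors of all the matrices $\mathcal{A}_\sigma(p)$ with $|\sigma|=k$; $H^2_{\mathcal{A}}$ is the bifocal ideal. Let $\mathfrak{m}=\bigcap_{i=1}^n\langle x_i,y_i,z_i\rangle$ be the multigraded irrelevant ideal, and let $I:\mathfrak{m}=\{f: fg\in I\text{ for all }g\in\mathfrak{m}\}$ denote the colon ideal. Then the following are equivalent: (a) the foci of $\mathcal{A}$ are noncoplanar, i.e. no plane of $\mathbb{P}^3_{\mathbb{R}}$ contains all of them; (b) $H^n_{\mathcal{A}}\subseteq H^2_{\mathcal{A}}$; (c) $M_{\mathcal{A}}=H^2_{\mathcal{A}}:\mathfrak{m}$. -/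

import Mathlib

open scoped LinearAlgebra.Projectivization

noncomputable section

namespace Multiview

/-- A (general projective) camera: a real `3 × 4` matrix of rank three. -/
structure Camera where
  mat : Matrix (Fin 3) (Fin 4) ℝ
  rank_mat : mat.rank = 3

lemma Camera.finrank_ker (A : Camera) :
    Module.finrank ℝ (LinearMap.ker A.mat.mulVecLin) = 1 := by
  have h := LinearMap.finrank_range_add_finrank_ker A.mat.mulVecLin
  have h' : Module.finrank ℝ (LinearMap.range A.mat.mulVecLin) = 3 := A.rank_mat
  simp only [h', Module.finrank_fin_fun] at h
  omega

/-- The focal point of a camera: the unique point of real projective 3-space given by the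
one-dimensional kernel of the camera matrix. -/
def Camera.focus (A : Camera) : ℙ ℝ (Fin 4 → ℝ) :=
  Projectivization.mk'' (LinearMap.ker A.mat.mulVecLin) A.finrank_ker

/-- The foci of the arrangement lie on a common plane of projective 3-space; `v` is the normal
vector of the plane. -/
def IsCoplanar {n : ℕ} (A : Fin n → Camera) : Prop :=
  ∃ v : ℙ ℝ (Fin 4 → ℝ), ∀ i, Projectivization.orthogonal v (A i).focus

/-- The ring `ℂ[p₁, …, pₙ]`, `pᵢ = (xᵢ, yᵢ, zᵢ)`: the variables `(i, 0)`, `(i, 1)`, `(i, 2)` are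
`xᵢ`, `yᵢ`, `zᵢ`. -/
abbrev PolyRing (n : ℕ) : Type := MvPolynomial (Fin n × Fin 3) ℂ

/-- The image of the world point `q` in the camera `A`, as a vector of homogeneous coordinates. -/
def Camera.image (A : Camera) (q : Fin 4 → ℝ) : Fin 3 → ℂ :=
  fun j => ((A.mat.mulVec q j : ℝ) : ℂ)

/-- The joint image `φ_A(ℙ³_ℝ)`, as a subset of `(ℙ²_ℂ)ⁿ`: the tuples of images of the real world
points that are not a focal point of any of the cameras. -/
def jointImage {n : ℕ} (A : Fin n → Camera) : Set (Fin n → ℙ ℂ (Fin 3 → ℂ)) :=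
  {P | ∃ q : Fin 4 → ℝ, q ≠ 0 ∧
    ∀ i, ∃ h : (A i).image q ≠ 0, P i = Projectivization.mk ℂ ((A i).image q) h}

/-- The vanishing ideal of a subset `S` of `(ℙ²_ℂ)ⁿ`: the polynomials that vanish at every choice
of homogeneous coordinates, one vector for each factor, of every point of `S`. -/
def vanishingIdeal {n : ℕ} (S : Set (Fin n → ℙ ℂ (Fin 3 → ℂ))) : Ideal (PolyRing n) where
  carrier := {f | ∀ P ∈ S, ∀ u : Fin n → Fin 3 → ℂ,
    (∀ i, ∃ h : u i ≠ 0, Projectivization.mk ℂ (u i) h = P i) →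
      MvPolynomial.eval (fun v => u v.1 v.2) f = 0}
  add_mem' hf hg P hP u hu := by
    rw [map_add, hf P hP u hu, hg P hP u hu, add_zero]
  zero_mem' _ _ _ _ := map_zero _
  smul_mem' c f hf P hP u hu := by
    rw [smul_eq_mul, map_mul, hf P hP u hu, mul_zero]

/-- The multiview ideal `M_A`. -/
def multiviewIdeal {n : ℕ} (A : Fin n → Camera) : Ideal (PolyRing n) :=
  vanishingIdeal (jointImage A)

/-- The ideal generated by the `k × k` minors of a matrix. (Rows and columns may be chosen in any
order, which only affects the signs of the minors.) -/
def minors {R α β : Type*} [CommRing R] (k : ℕ) (M : Matrix α β R) : Ideal R :=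
  Ideal.span {d | ∃ (r : Fin k ↪ α) (c : Fin k ↪ β), d = (M.submatrix r c).det}

/-- The partially symbolic matrix `A_σ(p)` of size `3k × (4 + k)`, `k = |σ|`: its block row at
`i ∈ σ` is the matrix of camera `i`, followed by `pᵢ` in the column of `i` and zeros elsewhere. -/
def symbolicMatrix {n : ℕ} (A : Fin n → Camera) (σ : Finset (Fin n)) :
    Matrix (σ × Fin 3) (Fin 4 ⊕ σ) (PolyRing n) :=
  Matrix.of fun r c => match c with
    | Sum.inl j => MvPolynomial.C (((A r.1).mat r.2 j : ℝ) : ℂ)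
    | Sum.inr i => if i = r.1 then MvPolynomial.X ((r.1 : Fin n), r.2) else 0

/-- The `k`-focal ideal `H_A^k`: the sum, over all `k`-element sets `σ` of cameras, of the ideals
of maximal minors of `A_σ(p)`. -/
def focalIdeal {n : ℕ} (A : Fin n → Camera) (k : ℕ) : Ideal (PolyRing n) :=
  ⨆ σ ∈ Finset.powersetCard k (Finset.univ : Finset (Fin n)), minors (4 + k) (symbolicMatrix A σ)

/-- The multigraded irrelevant ideal: the intersection of the ideals `⟨xᵢ, yᵢ, zᵢ⟩`. -/
def irrelevantIdeal (n : ℕ) : Ideal (PolyRing n) :=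
  ⨅ i : Fin n, Ideal.span (Set.range fun j : Fin 3 => MvPolynomial.X (i, j))

end Multiview

end

/-!
Write `Φ` for the substitution `pᵢ ↦ tᵢ • Aᵢ q` with indeterminate `tᵢ` and `q`; the multiview ideal
is its kernel. A linear form in `pᵢ` is the same as a linear form in `q` vanishing at the focus
`fᵢ`. In these terms the bifocals say that two linear forms with a common value on `q` may be
exchanged between two cameras, and this is all that the main argument uses.

Suppose that the foci span the space. A sum of products of linear forms, one for each camera, is
then a bifocal combination as soon as it vanishes identically in `q`, by induction on the number of
cameras and exactness of the Koszul complex. The `n`-focals are such sums.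
For the colon ideal, choose three forms for each camera such that all the chosen forms are in
general position as far as the foci permit. A relation between four of them rewrites monomials
modulo bifocals, up to a product of one form for each camera, into standard ones, whose images
under `Φ` are linearly independent.

If the foci lie in a plane, choose a point `ωᵢ` of that plane for each camera. The line through
`fᵢ` and `ωᵢ` is all that the image of `ωᵢ` determines, and any two such lines meet, so the
bifocals vanish at the tuple of images. Since the `ωᵢ` can be chosen such that no point lies on all
of these lines, some `n`-focal does not vanish there.
-/

noncomputable section

namespace Multiview

open MvPolynomial Matrix

section Polynomials

variable {τ S : Type*} [CommRing S]

lemma homogeneousComponent_mul {p : MvPolynomial τ S} {m : ℕ} (hp : p.IsHomogeneous m) (n : ℕ)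
    (q : MvPolynomial τ S) :
    homogeneousComponent (m + n) (p * q) = p * homogeneousComponent n q := by
  let := gradedAlgebra (σ := τ) (R := S)
  rw [← decomposition.decompose'_apply, ← decomposition.decompose'_apply]
  exact DirectSum.coe_decompose_mul_add_of_left_mem (homogeneousSubmodule τ S) hp

lemma mem_span_X_image_of_X_mul_mem {s : Set τ} {i : τ} (hi : i ∉ s) {p : MvPolynomial τ S}
    (h : X i * p ∈ Ideal.span (X '' s)) : p ∈ Ideal.span (X '' s) := by
  rw [mem_ideal_span_X_image] at h ⊢
  intro m hm
  obtain ⟨j, hj, hmj⟩ := h (Finsupp.single i 1 + m) (by simpa [coeff_X_mul] using hm)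
  refine ⟨j, hj, ?_⟩
  rwa [Finsupp.add_apply, Finsupp.single_eq_of_ne (by rintro rfl; exact hi hj), zero_add] at hmj

lemma exists_eq_crossProduct_of_X_dotProduct_eq_zero [IsDomain S] (e : Fin 3 ↪ τ)
    {v : Fin 3 → MvPolynomial τ S} (h : (fun j => X (e j)) ⬝ᵥ v = 0) :
    ∃ u : Fin 3 → MvPolynomial τ S, v = (fun j => X (e j)) ⨯₃ u := by
  rw [vec3_dotProduct] at h
  have h0 : v 0 ∈ Ideal.span (X '' {e 1, e 2}) := by
    refine mem_span_X_image_of_X_mul_mem (i := e 0) (by simp) ?_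
    rw [Set.image_pair, Ideal.mem_span_pair]
    exact ⟨-v 1, -v 2, by linear_combination -h⟩
  rw [Set.image_pair, Ideal.mem_span_pair] at h0
  obtain ⟨a, b, hab⟩ := h0
  have h12 : X (e 1) * (v 1 + X (e 0) * a) + X (e 2) * (v 2 + X (e 0) * b) = 0 := by
    linear_combination h + X (e 0) * hab
  have h1 : v 1 + X (e 0) * a ∈ Ideal.span (X '' {e 2}) := by
    refine mem_span_X_image_of_X_mul_mem (i := e 1) (by simp) ?_
    rw [Set.image_singleton, Ideal.mem_span_singleton']
    exact ⟨-(v 2 + X (e 0) * b), by linear_combination -h12⟩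
  rw [Set.image_singleton, Ideal.mem_span_singleton'] at h1
  obtain ⟨c, hc⟩ := h1
  have h2 : v 2 + X (e 0) * b + X (e 1) * c = 0 := by
    refine (mul_eq_zero.1 ?_).resolve_left (X_ne_zero (e 2))
    linear_combination h12 + X (e 1) * hc
  refine ⟨![c, -b, a], ?_⟩
  rw [cross_apply]
  ext1 j
  fin_cases j
  · simpa using by linear_combination -hab
  · simpa using by linear_combination -hc
  · simpa using by linear_combination h2

lemma eq_single_of_mem_support {p : MvPolynomial τ S} {n : ℕ} (hp : p.IsHomogeneous n)
    {m : τ →₀ ℕ} (hm : m ∈ p.support) {i : τ} (h : ∀ j ≠ i, m j = 0) :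
    m = Finsupp.single i n := by
  have hmi : m = Finsupp.single i (m i) := Finsupp.eq_single_iff.2
    ⟨fun j hj => by_contra fun hji => Finsupp.mem_support_iff.1 hj (h j (by simpa using hji)), rfl⟩
  have hdeg := hp (mem_support_iff.1 hm)
  rw [hmi, Finsupp.weight_single, Pi.one_apply, smul_eq_mul, mul_one] at hdeg
  rwa [hdeg] at hmi

lemma eval_single_one [DecidableEq τ] {p : MvPolynomial τ S} {n : ℕ} (hp : p.IsHomogeneous n)
    (i : τ) : eval (Pi.single i 1) p = coeff (Finsupp.single i n) p := by
  rw [eval_eq, Finset.sum_eq_single (Finsupp.single i n)]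
  · rw [Finset.prod_eq_one, mul_one]
    intro j hj
    rw [Finset.mem_singleton.1 (Finsupp.support_single_subset hj), Pi.single_eq_same, one_pow]
  · intro d hd hne
    obtain ⟨j, hji, hj⟩ : ∃ j, j ≠ i ∧ d j ≠ 0 := by
      by_contra! hcon
      exact hne (eq_single_of_mem_support hp hd hcon)
    rw [Finset.prod_eq_zero (Finsupp.mem_support_iff.2 hj), mul_zero]
    rw [Pi.single_eq_of_ne hji, zero_pow hj]
  · intro hn
    rw [notMem_support_iff.1 hn, zero_mul]

lemma mem_span_X_compl_singleton [DecidableEq τ] {p : MvPolynomial τ S} {n : ℕ}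
    (hp : p.IsHomogeneous n) {i : τ} (h : eval (Pi.single i 1) p = 0) :
    p ∈ Ideal.span (X '' {i}ᶜ) := by
  rw [mem_ideal_span_X_image]
  intro m hm
  by_contra! hcon
  rw [eval_single_one hp, ← eq_single_of_mem_support hp hm hcon] at h
  exact mem_support_iff.1 hm h

end Polynomials

section LinearForms

variable {τ K : Type*} [Fintype τ] [CommRing K]

/-- The linear form with a given vector of coefficients. -/
def linearForm : (τ → K) →ₗ[K] MvPolynomial τ K :=
  Fintype.linearCombination K X

lemma linearForm_apply (w : τ → K) : linearForm w = ∑ k, C (w k) * X k := by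
  simp only [linearForm, Fintype.linearCombination_apply, smul_eq_C_mul]

@[simp] lemma eval_linearForm (w x : τ → K) : eval x (linearForm w) = w ⬝ᵥ x := by
  simp [linearForm_apply, dotProduct]

lemma isHomogeneous_linearForm (w : τ → K) : (linearForm w).IsHomogeneous 1 := by
  rw [linearForm_apply]
  exact IsHomogeneous.sum _ _ _ fun k _ => isHomogeneous_C_mul_X _ k

lemma linearForm_single [DecidableEq τ] (k : τ) : linearForm (Pi.single k (1 : K)) = X k := by
  simp [linearForm]

/-- The substitution of the linear form with coefficients `G k` for the variable `k`. -/
def linSubst (G : Matrix τ τ K) : MvPolynomial τ K →ₐ[K] MvPolynomial τ K :=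
  aeval fun k => linearForm (G k)

@[simp] lemma linSubst_X (G : Matrix τ τ K) (k : τ) : linSubst G (X k) = linearForm (G k) := by
  simp [linSubst]

lemma linSubst_linearForm (G : Matrix τ τ K) (w : τ → K) :
    linSubst G (linearForm w) = linearForm (w ᵥ* G) := by
  rw [vecMul_eq_sum, map_sum]
  simp only [linearForm, Fintype.linearCombination_apply, map_sum, map_smul, linSubst_X]

lemma eval_linSubst (G : Matrix τ τ K) (x : τ → K) (p : MvPolynomial τ K) :
    eval x (linSubst G p) = eval (G *ᵥ x) p := by
  have h : (eval x).comp (linSubst G).toRingHom = eval (G *ᵥ x) := by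
    ext k <;> simp [linSubst, mulVec]
  exact congr($h p)

lemma isHomogeneous_linSubst (G : Matrix τ τ K) {p : MvPolynomial τ K} {n : ℕ}
    (hp : p.IsHomogeneous n) : (linSubst G p).IsHomogeneous n := by
  simpa [linSubst] using
    hp.aeval (fun k => linearForm (G k)) (n := 1) (fun k => isHomogeneous_linearForm _)

lemma linSubst_linSubst_of_mul_eq_one [DecidableEq τ] {G H : Matrix τ τ K} (h : G * H = 1)
    (p : MvPolynomial τ K) : linSubst H (linSubst G p) = p := by
  have hcomp : (linSubst H).comp (linSubst G) = AlgHom.id K _ := by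
    refine MvPolynomial.algHom_ext fun k => ?_
    rw [AlgHom.comp_apply, linSubst_X, linSubst_linearForm, AlgHom.id_apply, ← linearForm_single k]
    congr 1
    ext j
    rw [← Matrix.mul_apply_eq_vecMul, h, one_apply, Pi.single_apply]
    simp only [eq_comm]
  exact congr($hcomp p)

end LinearForms

section Koszul

variable {K : Type*} [Field K]

lemma exists_eq_linearForm_dotProduct {r : ℕ} {G H : Matrix (Fin (r + 1)) (Fin (r + 1)) K}
    (hGH : G * H = 1) {n : ℕ} {p : MvPolynomial (Fin (r + 1)) K} (hp : p.IsHomogeneous (n + 1))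
    (h : eval (H.col (Fin.last r)) p = 0) :
    ∃ a : Fin r → MvPolynomial (Fin (r + 1)) K, (∀ j, (a j).IsHomogeneous n) ∧
      p = (fun j => linearForm (G j.castSucc)) ⬝ᵥ a := by
  have hpH := isHomogeneous_linSubst H hp
  have hspan : linSubst H p ∈ Ideal.span (Set.range fun j : Fin r => X j.castSucc) := by
    have hmem := mem_span_X_compl_singleton hpH (i := Fin.last r)
      (by rw [eval_linSubst, mulVec_single_one, h])
    rwa [← Fin.range_succAbove, ← Set.range_comp, Fin.succAbove_last] at hmem
  obtain ⟨a, ha⟩ := Ideal.mem_span_range_iff_exists_fun.1 hspan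
  refine ⟨fun j => linSubst G (homogeneousComponent n (a j)),
    fun j => isHomogeneous_linSubst G (homogeneousComponent_isHomogeneous _ _), ?_⟩
  have hcomp : linSubst H p = ∑ j, X j.castSucc * homogeneousComponent n (a j) := by
    rw [← homogeneousComponent_eq_self hpH, ← ha, map_sum, add_comm n]
    exact Finset.sum_congr rfl fun j _ => by
      rw [mul_comm, homogeneousComponent_mul (isHomogeneous_X K _)]
  rw [← linSubst_linSubst_of_mul_eq_one (mul_eq_one_comm.1 hGH) p, hcomp, map_sum]
  simp only [map_mul, linSubst_X, dotProduct]

lemma map_crossProduct {A B : Type*} [CommRing A] [CommRing B] (f : A →+* B) (v w : Fin 3 → A) :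
    f ∘ (v ⨯₃ w) = (f ∘ v) ⨯₃ (f ∘ w) := by
  ext j
  fin_cases j <;> simp [cross_apply]

lemma exists_isHomogeneous_eq_X_crossProduct {τ : Type*} (e : Fin 3 ↪ τ) {n : ℕ}
    {v : Fin 3 → MvPolynomial τ K} (hv : ∀ j, (v j).IsHomogeneous (n + 1))
    (h : (fun j => X (e j)) ⬝ᵥ v = 0) :
    ∃ u : Fin 3 → MvPolynomial τ K, (∀ j, (u j).IsHomogeneous n) ∧
      v = (fun j => X (e j)) ⨯₃ u := by
  obtain ⟨u, hu⟩ := exists_eq_crossProduct_of_X_dotProduct_eq_zero e h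
  have hmul (j k) : homogeneousComponent (n + 1) (X (e j) * u k) =
      X (e j) * homogeneousComponent n (u k) := by
    rw [add_comm, homogeneousComponent_mul (isHomogeneous_X K _)]
  refine ⟨fun j => homogeneousComponent n (u j),
    fun j => homogeneousComponent_isHomogeneous _ _, ?_⟩
  ext1 j
  rw [← homogeneousComponent_eq_self (hv j), hu, cross_apply, cross_apply]
  fin_cases j <;> simp [hmul]

lemma exists_isHomogeneous_eq_linearForm_crossProduct {τ : Type*} [Fintype τ] [DecidableEq τ]
    {G H : Matrix τ τ K} (hGH : G * H = 1) (e : Fin 3 ↪ τ) {n : ℕ} {v : Fin 3 → MvPolynomial τ K}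
    (hv : ∀ j, (v j).IsHomogeneous (n + 1)) (h : (fun j => linearForm (G (e j))) ⬝ᵥ v = 0) :
    ∃ u : Fin 3 → MvPolynomial τ K, (∀ j, (u j).IsHomogeneous n) ∧
      v = (fun j => linearForm (G (e j))) ⨯₃ u := by
  obtain ⟨u, hu, huv⟩ : ∃ u : Fin 3 → MvPolynomial τ K, (∀ j, (u j).IsHomogeneous n) ∧
      linSubst H ∘ v = (fun j => X (e j)) ⨯₃ u := by
    refine exists_isHomogeneous_eq_X_crossProduct e (fun j => isHomogeneous_linSubst H (hv j)) ?_
    have hH := congrArg (linSubst H) h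
    simpa only [dotProduct, Function.comp_apply, map_sum, map_mul, map_zero, ← linSubst_X,
      linSubst_linSubst_of_mul_eq_one hGH] using hH
  refine ⟨linSubst G ∘ u, fun j => isHomogeneous_linSubst G (hu j), ?_⟩
  have hX : (fun j => linearForm (G (e j))) = linSubst G ∘ fun j => X (e j) :=
    funext fun j => (linSubst_X G (e j)).symm
  have hHG : H * G = 1 := mul_eq_one_comm.1 hGH
  have hv_eq : v = linSubst G ∘ (linSubst H ∘ v) := by
    ext1 j
    simp only [Function.comp_apply, linSubst_linSubst_of_mul_eq_one hHG]
  rw [hX, hv_eq, huv]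
  exact map_crossProduct (linSubst G : MvPolynomial τ K →+* MvPolynomial τ K) _ u

lemma exists_dotProduct_eq_one {p : Fin 3 → K} (hp : p ≠ 0) : ∃ w, w ⬝ᵥ p = 1 := by
  obtain ⟨j, hj⟩ := Function.ne_iff.1 hp
  exact ⟨Pi.single j (p j)⁻¹, by simpa using inv_mul_cancel₀ hj⟩

lemma exists_eq_crossProduct {p v : Fin 3 → K} (hp : p ≠ 0) (h : p ⬝ᵥ v = 0) :
    ∃ a, v = p ⨯₃ a := by
  obtain ⟨w, hw⟩ := exists_dotProduct_eq_one hp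
  exact ⟨v ⨯₃ w, by
    rw [cross_cross_eq_smul_sub_smul', dotProduct_comm p w, dotProduct_comm v p, h, hw, one_smul,
      zero_smul, sub_zero]⟩

lemma exists_eq_smul_of_crossProduct_eq_zero {p v : Fin 3 → K} (hp : p ≠ 0) (h : p ⨯₃ v = 0) :
    ∃ c : K, v = c • p := by
  obtain ⟨w, hw⟩ := exists_dotProduct_eq_one hp
  have hcross := cross_cross_eq_smul_sub_smul' w p v
  rw [h, map_zero, dotProduct_comm p w, hw, one_smul] at hcross
  exact ⟨_, (sub_eq_zero.1 hcross.symm).symm⟩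

end Koszul

section Interpolation

variable {ι τ K : Type*} [Field K] {f : ι → τ → K} {σ : Finset ι}

lemma exists_isHomogeneous_eval_eq {m : ℕ}
    (hδ : ∀ i ∈ σ, ∃ δ : MvPolynomial τ K, δ.IsHomogeneous m ∧ eval (f i) δ ≠ 0 ∧
      ∀ j ∈ σ, j ≠ i → eval (f j) δ = 0) (c : ι → K) :
    ∃ e : MvPolynomial τ K, e.IsHomogeneous m ∧ ∀ i ∈ σ, eval (f i) e = c i := by
  choose! δ hhom hne hzero using hδ
  refine ⟨∑ i ∈ σ, C (c i / eval (f i) (δ i)) * δ i,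
    IsHomogeneous.sum _ _ _ fun i hi => (hhom i hi).C_mul _, fun i hi => ?_⟩
  rw [map_sum, Finset.sum_eq_single_of_mem i hi]
  · simp [hne i hi]
  · intro j hj hji
    simp [hzero j hj i hi hji.symm]

lemma exists_dotProduct_eq_zero_and_ne_zero [Fintype τ] {W : Submodule K (τ → K)} {x : τ → K}
    (h : x ∉ W) :
    ∃ w, (∀ y ∈ W, w ⬝ᵥ y = 0) ∧ w ⬝ᵥ x ≠ 0 := by
  classical
  obtain ⟨φ, hφx, hφ⟩ := Submodule.exists_le_ker_of_notMem h
  obtain ⟨w, rfl⟩ := (dotProductEquiv K τ).surjective φ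
  exact ⟨w, fun y hy => hφ hy, hφx⟩

lemma exists_isHomogeneous_eval_ne_zero [Finite τ] {x : τ → K}
    (hsep : ∀ j ∈ σ, x ∉ Submodule.span K {f j}) :
    ∃ δ : MvPolynomial τ K, δ.IsHomogeneous σ.card ∧ eval x δ ≠ 0 ∧ ∀ j ∈ σ, eval (f j) δ = 0 := by
  have := Fintype.ofFinite τ
  choose! w hw hwx using fun j hj => exists_dotProduct_eq_zero_and_ne_zero (hsep j hj)
  refine ⟨∏ j ∈ σ, linearForm (w j), ?_, ?_, fun j hj => ?_⟩
  · simpa using IsHomogeneous.prod σ (fun j => linearForm (w j)) (fun _ => 1)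
      fun j _ => isHomogeneous_linearForm _
  · rw [map_prod]
    exact Finset.prod_ne_zero_iff.2 fun j hj => by simpa using hwx j hj
  · rw [map_prod]
    exact Finset.prod_eq_zero hj (by simpa using hw j hj _ (Submodule.mem_span_singleton_self _))

end Interpolation

section Correction

variable {ι τ K : Type*} [Fintype τ] [Field K] {f : ι → τ → K} {σ : Finset ι}
  {w : Fin 3 → τ → K}

lemma isHomogeneous_linearForm_crossProduct {n : ℕ} {u : Fin 3 → MvPolynomial τ K}
    (hu : ∀ j, (u j).IsHomogeneous n) (j : Fin 3) :
    (((fun j => linearForm (w j)) ⨯₃ u) j).IsHomogeneous (n + 1) := by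
  have hmul (j k) : (linearForm (w j) * u k).IsHomogeneous (n + 1) :=
    add_comm 1 n ▸ (isHomogeneous_linearForm (w j)).mul (hu k)
  rw [cross_apply]
  fin_cases j <;> exact (hmul _ _).sub (hmul _ _)

lemma eval_linearForm_crossProduct (x : τ → K) (u : Fin 3 → MvPolynomial τ K) :
    eval x ∘ ((fun j => linearForm (w j)) ⨯₃ u) = (fun j => w j ⬝ᵥ x) ⨯₃ (eval x ∘ u) := by
  have hw : eval x ∘ (fun j => linearForm (w j)) = fun j => w j ⬝ᵥ x :=
    funext fun j => eval_linearForm (w j) x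
  rw [map_crossProduct, hw]

lemma exists_eval_eq_zero_and_crossProduct_eq {n : ℕ}
    (hδ : ∀ i ∈ σ, ∃ δ : MvPolynomial τ K, δ.IsHomogeneous n ∧ eval (f i) δ ≠ 0 ∧
      ∀ j ∈ σ, j ≠ i → eval (f j) δ = 0)
    (hw : ∀ i ∈ σ, (fun j => w j ⬝ᵥ f i) ≠ 0) {u : Fin 3 → MvPolynomial τ K}
    (hu : ∀ j, (u j).IsHomogeneous (n + 1))
    (hcross : ∀ i ∈ σ, eval (f i) ∘ ((fun j => linearForm (w j)) ⨯₃ u) = 0) :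
    ∃ h : Fin 3 → MvPolynomial τ K, (∀ j, (h j).IsHomogeneous (n + 1)) ∧
      (∀ j, ∀ i ∈ σ, eval (f i) (h j) = 0) ∧
      (fun j => linearForm (w j)) ⨯₃ u = (fun j => linearForm (w j)) ⨯₃ h := by
  have hprop (i) (hi : i ∈ σ) : ∃ c : K, eval (f i) ∘ u = c • fun j => w j ⬝ᵥ f i :=
    exists_eq_smul_of_crossProduct_eq_zero (hw i hi)
      (by rw [← eval_linearForm_crossProduct, hcross i hi])
  choose! c hc using hprop
  obtain ⟨e, he, hec⟩ := exists_isHomogeneous_eval_eq hδ c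
  refine ⟨u - e • fun j => linearForm (w j),
    fun j => (hu j).sub (he.mul (isHomogeneous_linearForm _)), fun j i hi => ?_, ?_⟩
  · have hj := congrFun (hc i hi) j
    rw [Function.comp_apply, Pi.smul_apply, smul_eq_mul] at hj
    rw [Pi.sub_apply, map_sub, hj, Pi.smul_apply, smul_eq_mul, map_mul, hec i hi, eval_linearForm,
      sub_self]
  · rw [map_sub, map_smul, cross_self, smul_zero, sub_zero]

lemma exists_linearForm_dotProduct_eq_zero_and_eval_eq
    (hsep : ∀ i ∈ σ, ∀ j ∈ σ, i ≠ j → f i ∉ Submodule.span K {f j})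
    (hw : ∀ i ∈ σ, (fun j => w j ⬝ᵥ f i) ≠ 0) {b : Fin 3 → MvPolynomial τ K}
    (hb : ∀ i ∈ σ, eval (f i) ((fun j => linearForm (w j)) ⬝ᵥ b) = 0) :
    ∃ e : Fin 3 → MvPolynomial τ K, (∀ j, (e j).IsHomogeneous σ.card) ∧
      (fun j => linearForm (w j)) ⬝ᵥ e = 0 ∧ ∀ i ∈ σ, eval (f i) ∘ e = eval (f i) ∘ b := by
  classical
  rcases σ.eq_empty_or_nonempty with rfl | hσ
  · exact ⟨0, fun _ => isHomogeneous_zero _ _ _, dotProduct_zero _, by simp⟩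
  have hcross (i) (hi : i ∈ σ) : ∃ v, eval (f i) ∘ b = (fun j => w j ⬝ᵥ f i) ⨯₃ v := by
    refine exists_eq_crossProduct (hw i hi) ?_
    simpa only [dotProduct, Function.comp_apply, map_sum, map_mul, eval_linearForm] using hb i hi
  choose! v hv using hcross
  have hδ (i) (hi : i ∈ σ) : ∃ δ : MvPolynomial τ K, δ.IsHomogeneous (σ.card - 1) ∧
      eval (f i) δ ≠ 0 ∧ ∀ j ∈ σ, j ≠ i → eval (f j) δ = 0 := by
    obtain ⟨δ, hhom, hne, hzero⟩ := exists_isHomogeneous_eval_ne_zero (f := f) (σ := σ.erase i)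
      fun j hj => hsep i hi j (Finset.mem_of_mem_erase hj) (Finset.ne_of_mem_erase hj).symm
    exact ⟨δ, Finset.card_erase_of_mem hi ▸ hhom, hne,
      fun j hj hji => hzero j (Finset.mem_erase.2 ⟨hji, hj⟩)⟩
  choose u hu huv using fun k => exists_isHomogeneous_eval_eq hδ (fun i => v i k)
  refine ⟨(fun j => linearForm (w j)) ⨯₃ u, fun j => ?_, dot_self_cross _ _, fun i hi => ?_⟩
  · rw [← Nat.sub_add_cancel hσ.card_pos]
    exact isHomogeneous_linearForm_crossProduct hu j
  · rw [eval_linearForm_crossProduct, hv i hi]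
    congr
    exact funext fun k => huv k i hi

/-- The `k`-th of three forms already vanishes at two of the points, which saves one degree. -/
lemma exists_isHomogeneous_card_sub_two
    (hsep : ∀ i ∈ σ, ∀ j ∈ σ, i ≠ j → f i ∉ Submodule.span K {f j}) {κ : Fin 3 → ι}
    (hκ : Function.Injective κ) (hκσ : ∀ k, κ k ∈ σ) (hwκ : ∀ k l, k ≠ l → w k ⬝ᵥ f (κ l) = 0)
    {i : ι} (hi : i ∈ σ) (hwi : (fun k => w k ⬝ᵥ f i) ≠ 0) :
    ∃ δ : MvPolynomial τ K, δ.IsHomogeneous (σ.card - 2) ∧ eval (f i) δ ≠ 0 ∧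
      ∀ j ∈ σ, j ≠ i → eval (f j) δ = 0 := by
  classical
  obtain ⟨k, hk⟩ := Function.ne_iff.1 hwi
  set ρ := insert i ((Finset.univ.erase k).image κ) with hρ
  have hiκ : i ∉ (Finset.univ.erase k).image κ := by
    intro h
    obtain ⟨l, hl, rfl⟩ := Finset.mem_image.1 h
    exact hk (hwκ k l (Finset.ne_of_mem_erase hl).symm)
  have hρσ : ρ ⊆ σ := Finset.insert_subset hi (Finset.image_subset_iff.2 fun l _ => hκσ l)
  have hρcard : ρ.card = 3 := by
    rw [hρ, Finset.card_insert_of_notMem hiκ, Finset.card_image_of_injective _ hκ,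
      Finset.card_erase_of_mem (Finset.mem_univ k), Finset.card_fin]
  obtain ⟨δ, hhom, hne, hzero⟩ := exists_isHomogeneous_eval_ne_zero (f := f) (σ := σ \ ρ)
    (x := f i) fun j hj => hsep i hi j (Finset.mem_sdiff.1 hj).1 fun hij =>
      (Finset.mem_sdiff.1 hj).2 (hij ▸ Finset.mem_insert_self _ _)
  refine ⟨δ * linearForm (w k), ?_, ?_, fun j hj hji => ?_⟩
  · have hcard : (σ \ ρ).card + 1 = σ.card - 2 := by
      have hle := Finset.card_le_card hρσ
      rw [Finset.card_sdiff_of_subset hρσ]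
      omega
    exact hcard ▸ hhom.mul (isHomogeneous_linearForm _)
  · rw [map_mul, eval_linearForm]
    exact mul_ne_zero hne hk
  · rw [map_mul, eval_linearForm]
    by_cases hjρ : j ∈ ρ
    · obtain ⟨l, hl, rfl⟩ := Finset.mem_image.1 ((Finset.mem_insert.1 hjρ).resolve_left hji)
      rw [hwκ k l (Finset.ne_of_mem_erase hl).symm, mul_zero]
    · rw [hzero j (Finset.mem_sdiff.2 ⟨hj, hjρ⟩), zero_mul]

end Correction

section Frames

variable {m K : Type*} [Fintype m] [DecidableEq m] [Field K] {G H : Matrix m m K}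

lemma exists_mul_eq_one_and_col_eq {v : m → K} (hv : v ≠ 0) (k : m) :
    ∃ G H : Matrix m m K, G * H = 1 ∧ H.col k = v := by
  obtain ⟨i, hi⟩ := Function.ne_iff.1 hv
  set H := ((1 : Matrix m m K).updateCol i v).submatrix id (Equiv.swap i k) with hH
  refine ⟨H⁻¹, H, nonsing_inv_mul _ ?_, ?_⟩
  · rw [hH, det_permute', ← cramer_apply, cramer_one]
    exact (Units.isUnit _).map (Int.castRingHom K) |>.mul (isUnit_iff_ne_zero.2 hi)
  · ext j
    simp [hH]

lemma exists_mul_eq_one_and_forall_col_eq {u : m → m → K} (hu : LinearIndependent K u) :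
    ∃ G H : Matrix m m K, G * H = 1 ∧ ∀ k, H.col k = u k :=
  ⟨(of u)ᵀ⁻¹, (of u)ᵀ, nonsing_inv_mul _ ((isUnit_iff_isUnit_det _).1
    (linearIndependent_cols_iff_isUnit.1 hu)), fun _ => rfl⟩

lemma dotProduct_col_of_mul_eq_one (hGH : G * H = 1) (k l : m) :
    G k ⬝ᵥ H.col l = if k = l then 1 else 0 := by
  rw [← one_apply, ← hGH]
  rfl

lemma rows_dotProduct_ne_zero {r : ℕ} {G H : Matrix (Fin (r + 1)) (Fin (r + 1)) K}
    (hGH : G * H = 1) {x : Fin (r + 1) → K}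
    (hx : x ∉ Submodule.span K {H.col (Fin.last r)}) :
    (fun j : Fin r => G j.castSucc ⬝ᵥ x) ≠ 0 := by
  refine fun hzero => hx (Submodule.mem_span_singleton.2 ⟨(G *ᵥ x) (Fin.last r), ?_⟩)
  have hGx : G *ᵥ x = Pi.single (Fin.last r) ((G *ᵥ x) (Fin.last r)) := by
    ext k
    refine Fin.lastCases (by simp) (fun j => ?_) k
    rw [Pi.single_eq_of_ne (Fin.castSucc_lt_last j).ne]
    exact congrFun hzero j
  calc (G *ᵥ x) (Fin.last r) • H.col (Fin.last r)
      = H *ᵥ Pi.single (Fin.last r) ((G *ᵥ x) (Fin.last r)) := by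
        rw [mulVec_single]
        ext
        simp [mul_comm]
    _ = x := by rw [← hGx, mulVec_mulVec, mul_eq_one_comm.1 hGH, one_mulVec]

end Frames

section Multilinear

/-- An algebra of images of points of 3-space in several cameras, as seen by multilinear algebra.
The linear form `w` on 3-space vanishes at the focus of camera `i` exactly when it is the pullback
of a linear form on the image plane of `i`; `form i w` is that form on the plane, extended linearly
to all `w` in an arbitrary way. The map `generic` takes the images of a generic point. The
`relations` contain, for each two cameras, the relations between the images of planes through both
foci. -/
structure TwoViewSystem (ι K R : Type*) [Field K] [CommRing R] [Algebra K R] where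
  focus : ι → Fin 4 → K
  focus_ne_zero : ∀ i, focus i ≠ 0
  focus_notMem_span : ∀ i j, i ≠ j → focus i ∉ Submodule.span K {focus j}
  relations : Ideal R
  form : ι → (Fin 4 → K) →ₗ[K] R
  generic : R →ₐ[K] MvPolynomial (Fin 4) K
  generic_form : ∀ i w, w ⬝ᵥ focus i = 0 → generic (form i w) = linearForm w
  exchange_mem : ∀ i j, i ≠ j → ∀ w w', w ⬝ᵥ focus i = 0 → w ⬝ᵥ focus j = 0 →
    w' ⬝ᵥ focus i = 0 → w' ⬝ᵥ focus j = 0 → form i w * form j w' - form i w' * form j w ∈ relations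

lemma crossProduct_apply_cyclic {A : Type*} [CommRing A] (v w : Fin 3 → A) (k : Fin 3) :
    (v ⨯₃ w) k = v (k + 1) * w (k + 2) - v (k + 2) * w (k + 1) := by
  rw [cross_apply]
  fin_cases k <;> rfl

lemma eq_sum_dotProduct_col_smul {m K : Type*} [Fintype m] [DecidableEq m] [Field K]
    {G H : Matrix m m K} (hGH : G * H = 1) (w : m → K) : w = ∑ j, (w ⬝ᵥ H.col j) • G j := by
  have hHG : H * G = 1 := mul_eq_one_comm.1 hGH
  calc w = (w ᵥ* H) ᵥ* G := by rw [vecMul_vecMul, hHG, vecMul_one]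
    _ = ∑ j, (w ⬝ᵥ H.col j) • G j := vecMul_eq_sum _ _

lemma dotProduct_mem_of_exchange {R : Type*} [CommRing R] {I : Ideal R} {p v : Fin 3 → R}
    {E : Fin 3 → Fin 3 → R} (hv : ∀ k, v k - (E (k + 1) (k + 2) - E (k + 2) (k + 1)) ∈ I)
    (hE : ∀ k l r, k ≠ r → l ≠ r → p k * E l r - p l * E k r ∈ I) : p ⬝ᵥ v ∈ I := by
  have hsum : ∑ k, (p k * (v k - (E (k + 1) (k + 2) - E (k + 2) (k + 1))) +
      (p (k + 1) * E (k + 2) k - p (k + 2) * E (k + 1) k)) ∈ I :=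
    sum_mem fun k _ => add_mem (I.mul_mem_left _ (hv k))
      (hE _ _ k (by simp) (by simp))
  convert hsum using 1
  simp only [dotProduct, Fin.sum_univ_three, Fin.isValue, Fin.reduceAdd, zero_add]
  ring

end Multilinear

namespace TwoViewSystem

variable {ι K R : Type*} [Field K] [CommRing R] [Algebra K R] (S : TwoViewSystem ι K R)
  {σ : Finset ι} {a : ι}

/-- The elements that are linear in the image of each camera in `σ` and do not involve the other
cameras: the span of the products of one linear form on each image plane. -/
def multilinear (σ : Finset ι) : Submodule K R :=
  Submodule.span K {F | ∃ w : ι → Fin 4 → K, (∀ i ∈ σ, w i ⬝ᵥ S.focus i = 0) ∧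
    F = ∏ i ∈ σ, S.form i (w i)}

/-- The relations contain all multilinear elements in the cameras `σ` that vanish on the images of
a generic point. -/
def Exact (σ : Finset ι) : Prop :=
  ∀ F ∈ S.multilinear σ, S.generic F = 0 → F ∈ S.relations

variable {S}

lemma smul_one_mem_multilinear_empty (c : K) : c • (1 : R) ∈ S.multilinear ∅ :=
  Submodule.smul_mem _ _ (Submodule.subset_span ⟨0, by simp, by simp⟩)

lemma prod_form_mem_multilinear {w : σ → Fin 4 → K} (hw : ∀ i : σ, w i ⬝ᵥ S.focus i = 0) :
    ∏ i : σ, S.form i (w i) ∈ S.multilinear σ := by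
  classical
  refine Submodule.subset_span
    ⟨fun i => if h : i ∈ σ then w ⟨i, h⟩ else 0, fun i hi => ?_, ?_⟩
  · simp only [dif_pos hi]
    exact hw ⟨i, hi⟩
  · rw [← Finset.prod_coe_sort σ]
    exact Finset.prod_congr rfl fun i _ => by simp only [dif_pos i.2]

lemma eval_generic_eq_zero {F : R} (hF : F ∈ S.multilinear σ) {i : ι} (hi : i ∈ σ) :
    eval (S.focus i) (S.generic F) = 0 := by
  induction hF using Submodule.span_induction with
  | mem x hx =>
    obtain ⟨w, hw, rfl⟩ := hx
    rw [map_prod, map_prod]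
    exact Finset.prod_eq_zero hi (by rw [S.generic_form _ _ (hw i hi), eval_linearForm, hw i hi])
  | zero => simp
  | add x y _ _ hx hy => rw [map_add, map_add, hx, hy, add_zero]
  | smul c x _ hx => rw [map_smul, smul_eval, hx, mul_zero]

lemma isHomogeneous_generic {F : R} (hF : F ∈ S.multilinear σ) :
    (S.generic F).IsHomogeneous σ.card := by
  induction hF using Submodule.span_induction with
  | mem x hx =>
    obtain ⟨w, hw, rfl⟩ := hx
    rw [map_prod]
    simpa using IsHomogeneous.prod σ (fun j => S.generic (S.form j (w j))) (fun _ => 1)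
      fun j hj => S.generic_form _ _ (hw j hj) ▸ isHomogeneous_linearForm _
  | zero => rw [map_zero]; exact isHomogeneous_zero _ _ _
  | add x y _ _ hx hy => rw [map_add]; exact hx.add hy
  | smul c x _ hx => rw [map_smul, smul_eq_C_mul]; exact hx.C_mul _

variable {G H : Matrix (Fin 4) (Fin 4) K}

lemma row_dotProduct_focus_eq_zero (hGH : G * H = 1) (hcol : H.col (Fin.last 3) = S.focus a)
    (j : Fin 3) : G j.castSucc ⬝ᵥ S.focus a = 0 := by
  rw [← hcol, dotProduct_col_of_mul_eq_one hGH, if_neg (Fin.castSucc_lt_last j).ne]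

lemma generic_form_row (hGH : G * H = 1) (hcol : H.col (Fin.last 3) = S.focus a) (j : Fin 3) :
    S.generic (S.form a (G j.castSucc)) = linearForm (G j.castSucc) :=
  S.generic_form _ _ (row_dotProduct_focus_eq_zero hGH hcol j)

lemma generic_form_row_dotProduct (hGH : G * H = 1) (hcol : H.col (Fin.last 3) = S.focus a)
    (F : Fin 3 → R) :
    S.generic ((fun j => S.form a (G j.castSucc)) ⬝ᵥ F) =
      (fun j => linearForm (G j.castSucc)) ⬝ᵥ (S.generic ∘ F) := by
  simp only [dotProduct, map_sum, map_mul, generic_form_row hGH hcol, Function.comp_apply]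

lemma rows_dotProduct_focus_ne_zero (hGH : G * H = 1) (hcol : H.col (Fin.last 3) = S.focus a)
    {i : ι} (hia : i ≠ a) :
    (fun j : Fin 3 => G j.castSucc ⬝ᵥ S.focus i) ≠ 0 :=
  rows_dotProduct_ne_zero hGH (hcol ▸ S.focus_notMem_span i a hia)

lemma exists_generic_eq_crossProduct {κ : Fin 4 → ι} {G H : Matrix (Fin 4) (Fin 4) K}
    (hGH : G * H = 1) (hcol : ∀ k, H.col k = S.focus (κ k)) (hκ : Function.Injective κ)
    (hκσ : ∀ k : Fin 3, κ k.castSucc ∈ σ) (ha : κ (Fin.last 3) ∉ σ) {F : Fin 3 → R}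
    (hF : ∀ j, F j ∈ S.multilinear σ)
    (hgen : (fun j => linearForm (G j.castSucc)) ⬝ᵥ (S.generic ∘ F) = 0) :
    ∃ h : Fin 3 → MvPolynomial (Fin 4) K, (∀ j, (h j).IsHomogeneous (σ.card - 1)) ∧
      (∀ j, ∀ i ∈ σ, eval (S.focus i) (h j) = 0) ∧
      S.generic ∘ F = (fun j => linearForm (G j.castSucc)) ⨯₃ h := by
  have hcard : 3 ≤ σ.card := by
    have hle := Finset.card_le_card_of_injOn (s := Finset.univ) (fun k : Fin 3 => κ k.castSucc)
      (fun k _ => hκσ k) (hκ.comp (Fin.castSucc_injective 3)).injOn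
    rwa [Finset.card_fin] at hle
  have hcard' : σ.card - 2 + 1 = σ.card - 1 := by omega
  have hrows (i) (hi : i ∈ σ) : (fun j : Fin 3 => G j.castSucc ⬝ᵥ S.focus i) ≠ 0 :=
    rows_dotProduct_focus_ne_zero hGH (hcol _) (ne_of_mem_of_not_mem hi ha)
  obtain ⟨u, hu, hFu⟩ := exists_isHomogeneous_eq_linearForm_crossProduct hGH Fin.castSuccEmb
    (n := σ.card - 2 + 1) (v := S.generic ∘ F)
    (fun j => by
      have hhom := isHomogeneous_generic (hF j)
      rwa [show σ.card = σ.card - 2 + 1 + 1 by omega] at hhom) hgen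
  obtain ⟨h, hh, hzero, huh⟩ := exists_eval_eq_zero_and_crossProduct_eq (f := S.focus)
    (fun i hi => exists_isHomogeneous_card_sub_two (fun i _ j _ => S.focus_notMem_span i j)
      (κ := fun k => κ k.castSucc) (hκ.comp (Fin.castSucc_injective 3)) hκσ
      (fun k l hkl => by
        rw [← hcol, dotProduct_col_of_mul_eq_one hGH,
          if_neg (Fin.castSucc_injective 3 |>.ne hkl)]) hi (hrows i hi))
    hrows hu fun i hi => by
      funext j
      rw [Function.comp_apply]
      have hj := congrFun hFu j
      simp only [Fin.coe_castSuccEmb] at hj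
      rw [← hj]
      exact eval_generic_eq_zero (hF j) hi
  exact ⟨h, hcard' ▸ hh, hzero, hFu.trans huh⟩

lemma form_mul_mem_multilinear [DecidableEq ι] (ha : a ∉ σ) {w : Fin 4 → K}
    (hw : w ⬝ᵥ S.focus a = 0) {F : R} (hF : F ∈ S.multilinear σ) :
    S.form a w * F ∈ S.multilinear (insert a σ) := by
  induction hF using Submodule.span_induction with
  | mem x hx =>
    obtain ⟨w', hw', rfl⟩ := hx
    have hupdate (i) (hi : i ∈ σ) : Function.update w' a w i = w' i :=
      Function.update_of_ne (ne_of_mem_of_not_mem hi ha) _ _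
    refine Submodule.subset_span ⟨Function.update w' a w, fun i hi => ?_, ?_⟩
    · rcases Finset.mem_insert.1 hi with rfl | hiσ
      · rwa [Function.update_self]
      · rw [hupdate i hiσ, hw' i hiσ]
    · rw [Finset.prod_insert ha, Function.update_self]
      exact congrArg _ (Finset.prod_congr rfl fun i hi => by rw [hupdate i hi])
  | zero => simp
  | add x y _ _ hx hy => rw [mul_add]; exact add_mem hx hy
  | smul c x _ hx => rw [mul_smul_comm]; exact Submodule.smul_mem _ _ hx

lemma form_row_dotProduct_mem_multilinear [DecidableEq ι] (hGH : G * H = 1)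
    (hcol : H.col (Fin.last 3) = S.focus a) (ha : a ∉ σ) {F : Fin 3 → R}
    (hF : ∀ j, F j ∈ S.multilinear σ) :
    (fun j => S.form a (G j.castSucc)) ⬝ᵥ F ∈ S.multilinear (insert a σ) :=
  sum_mem fun j _ =>
    form_mul_mem_multilinear ha (row_dotProduct_focus_eq_zero hGH hcol j) (hF j)

lemma exists_eq_form_row_dotProduct [DecidableEq ι] (hGH : G * H = 1)
    (hcol : H.col (Fin.last 3) = S.focus a) (ha : a ∉ σ) {F : R}
    (hF : F ∈ S.multilinear (insert a σ)) :
    ∃ F' : Fin 3 → R, (∀ j, F' j ∈ S.multilinear σ) ∧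
      F = (fun j => S.form a (G j.castSucc)) ⬝ᵥ F' := by
  induction hF using Submodule.span_induction with
  | mem x hx =>
    obtain ⟨w, hw, rfl⟩ := hx
    refine ⟨fun j => (w a ⬝ᵥ H.col j.castSucc) • ∏ i ∈ σ, S.form i (w i), fun j =>
      Submodule.smul_mem _ _ (Submodule.subset_span
        ⟨w, fun i hi => hw i (Finset.mem_insert_of_mem hi), rfl⟩), ?_⟩
    have hwa : w a ⬝ᵥ H.col (Fin.last 3) = 0 := hcol ▸ hw a (Finset.mem_insert_self _ _)
    have hform : S.form a (w a) =
        ∑ j : Fin 3, (w a ⬝ᵥ H.col j.castSucc) • S.form a (G j.castSucc) := by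
      conv_lhs => rw [eq_sum_dotProduct_col_smul hGH (w a), Fin.sum_univ_castSucc, hwa, zero_smul,
        add_zero, map_sum]
      simp only [map_smul]
    rw [Finset.prod_insert ha, hform, Finset.sum_mul]
    exact Finset.sum_congr rfl fun j _ => by rw [smul_mul_assoc, mul_smul_comm]
  | zero => exact ⟨0, fun _ => zero_mem _, (dotProduct_zero _).symm⟩
  | add x y _ _ hx hy =>
    obtain ⟨F, hF, rfl⟩ := hx
    obtain ⟨F', hF', rfl⟩ := hy
    exact ⟨F + F', fun j => add_mem (hF j) (hF' j), (dotProduct_add _ _ _).symm⟩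
  | smul c x _ hx =>
    obtain ⟨F, hF, rfl⟩ := hx
    exact ⟨c • F, fun j => Submodule.smul_mem _ _ (hF j), (dotProduct_smul _ _ _).symm⟩

theorem exists_mem_multilinear_generic_eq (σ : Finset ι) {g : MvPolynomial (Fin 4) K}
    (hg : g.IsHomogeneous σ.card) (hzero : ∀ i ∈ σ, eval (S.focus i) g = 0) :
    ∃ F ∈ S.multilinear σ, S.generic F = g := by
  classical
  induction σ using Finset.induction_on generalizing g with
  | empty =>
    have hgC := totalDegree_eq_zero_iff_eq_C.1 ((totalDegree_zero_iff_isHomogeneous _).2 hg)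
    exact ⟨coeff 0 g • 1, smul_one_mem_multilinear_empty _, by
      rw [map_smul, map_one, smul_eq_C_mul, mul_one, ← hgC]⟩
  | insert a σ ha ih =>
    obtain ⟨G, H, hGH, hcol⟩ := exists_mul_eq_one_and_col_eq (S.focus_ne_zero a) (Fin.last 3)
    rw [Finset.card_insert_of_notMem ha] at hg
    obtain ⟨b, hb, rfl⟩ := exists_eq_linearForm_dotProduct hGH hg
      (hcol ▸ hzero a (Finset.mem_insert_self _ _))
    obtain ⟨e, he, hsyz, heval⟩ := exists_linearForm_dotProduct_eq_zero_and_eval_eq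
      (fun i _ j _ => S.focus_notMem_span i j)
      (fun i hi => rows_dotProduct_focus_ne_zero hGH hcol (ne_of_mem_of_not_mem hi ha))
      (fun i hi => hzero i (Finset.mem_insert_of_mem hi))
    choose F hF hFbe using fun j => ih ((hb j).sub (he j)) fun i hi => by
      rw [map_sub, sub_eq_zero]
      exact (congrFun (heval i hi) j).symm
    refine ⟨_, form_row_dotProduct_mem_multilinear hGH hcol ha hF, ?_⟩
    have hFbe' : S.generic ∘ F = b - e := funext hFbe
    rw [generic_form_row_dotProduct hGH hcol, hFbe', dotProduct_sub, hsyz, sub_zero]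

lemma exists_mem_multilinear_sub_mem_relations (hσ : S.Exact σ) {j : ι} (hj : j ∈ σ)
    {g : MvPolynomial (Fin 4) K} (hg : g.IsHomogeneous (σ.card - 1))
    (hzero : ∀ i ∈ σ, eval (S.focus i) g = 0) :
    ∃ Q : R, ∀ w, w ⬝ᵥ S.focus j = 0 → ∀ F ∈ S.multilinear σ, S.generic F = linearForm w * g →
      F - S.form j w * Q ∈ S.relations := by
  classical
  obtain ⟨Q, hQ, rfl⟩ := exists_mem_multilinear_generic_eq (S := S) (σ.erase j)
    (Finset.card_erase_of_mem hj ▸ hg) fun i hi => hzero i (Finset.mem_of_mem_erase hi)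
  refine ⟨Q, fun w hw F hF hgen => hσ _ (sub_mem hF ?_) ?_⟩
  · rw [← Finset.insert_erase hj]
    exact form_mul_mem_multilinear (Finset.notMem_erase j σ) hw hQ
  · rw [map_sub, map_mul, S.generic_form _ _ hw, hgen, sub_self]

lemma form_mul_sub_form_mul_mem (hσ : S.Exact σ) (ha : a ∉ σ) {j : ι} (hj : j ∈ σ)
    {g : MvPolynomial (Fin 4) K} (hg : g.IsHomogeneous (σ.card - 1))
    (hzero : ∀ i ∈ σ, eval (S.focus i) g = 0) {w w' : Fin 4 → K} (hwa : w ⬝ᵥ S.focus a = 0)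
    (hwa' : w' ⬝ᵥ S.focus a = 0) (hwj : w ⬝ᵥ S.focus j = 0) (hwj' : w' ⬝ᵥ S.focus j = 0)
    {F F' : R} (hF : F ∈ S.multilinear σ) (hF' : F' ∈ S.multilinear σ)
    (hgen : S.generic F = linearForm w * g) (hgen' : S.generic F' = linearForm w' * g) :
    S.form a w * F' - S.form a w' * F ∈ S.relations := by
  obtain ⟨Q, hQ⟩ := exists_mem_multilinear_sub_mem_relations hσ hj hg hzero
  have hFQ := S.relations.mul_mem_left (S.form a w') (hQ w hwj F hF hgen)
  have hFQ' := S.relations.mul_mem_left (S.form a w) (hQ w' hwj' F' hF' hgen')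
  have hexchange := S.relations.mul_mem_left Q
    (S.exchange_mem a j (ne_of_mem_of_not_mem hj ha).symm w w' hwa hwj hwa' hwj')
  convert add_mem (sub_mem hFQ' hFQ) hexchange using 1
  ring

theorem Exact.insert [DecidableEq ι] (hσ : S.Exact σ) {κ : Fin 4 → ι}
    (hκ : LinearIndependent K (S.focus ∘ κ)) (hκσ : ∀ k : Fin 3, κ k.castSucc ∈ σ)
    (ha : κ (Fin.last 3) ∉ σ) : S.Exact (insert (κ (Fin.last 3)) σ) := by
  obtain ⟨G, H, hGH, hcol⟩ := exists_mul_eq_one_and_forall_col_eq hκ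
  simp only [Function.comp_apply] at hcol
  have hκinj : Function.Injective κ := hκ.injective.of_comp
  intro F hF hgen
  obtain ⟨F', hF', rfl⟩ := exists_eq_form_row_dotProduct hGH (hcol _) ha hF
  rw [generic_form_row_dotProduct hGH (hcol _)] at hgen
  obtain ⟨h, hh, hzero, hF'h⟩ := exists_generic_eq_crossProduct hGH hcol hκinj hκσ ha hF' hgen
  have hlift (k l : Fin 3) : ∃ E ∈ S.multilinear σ,
      S.generic E = linearForm (G k.castSucc) * h l := by
    refine exists_mem_multilinear_generic_eq σ ?_ fun i hi => by
      rw [map_mul, hzero l i hi, mul_zero]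
    have hcard : 1 + (σ.card - 1) = σ.card := by
      have := Finset.card_pos.2 ⟨_, hκσ 0⟩
      omega
    exact hcard ▸ (isHomogeneous_linearForm _).mul (hh l)
  choose E hE hEgen using hlift
  refine dotProduct_mem_of_exchange (E := E) (fun k => ?_) fun k l r hkr hlr => ?_
  · refine hσ _ (sub_mem (hF' k) (sub_mem (hE _ _) (hE _ _))) ?_
    have hk := congrFun hF'h k
    rw [Function.comp_apply, crossProduct_apply_cyclic] at hk
    rw [map_sub, map_sub, hEgen, hEgen, hk, sub_self]
  · have hrow (k : Fin 3) : k ≠ r → G k.castSucc ⬝ᵥ S.focus (κ r.castSucc) = 0 := fun hk => by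
      rw [← hcol, dotProduct_col_of_mul_eq_one hGH, if_neg ((Fin.castSucc_injective 3).ne hk)]
    exact form_mul_sub_form_mul_mem hσ ha (hκσ r) (hh r) (hzero r)
      (row_dotProduct_focus_eq_zero hGH (hcol _) k) (row_dotProduct_focus_eq_zero hGH (hcol _) l)
      (hrow k hkr) (hrow l hlr) (hE k r) (hE l r) (hEgen k r) (hEgen l r)

end TwoViewSystem

section Words

/-- A choice of one of four coordinate forms for each of four cameras whose foci are the coordinate
points. -/
abbrev Word : Type := Fin 4 → Fin 4

namespace Word

/-- The coordinate form chosen for a camera vanishes at the focus of that camera. -/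
def Valid (x : Word) : Prop :=
  ∀ i, x i ≠ i

/-- Sorts the letters of a word at two positions, provided that both coordinate forms vanish at
both foci, so that their exchange is one of the relations between the two views. -/
def sort (i j : Fin 4) (x : Word) : Word :=
  if x j < x i ∧ x i ≠ i ∧ x i ≠ j ∧ x j ≠ i ∧ x j ≠ j then x ∘ Equiv.swap i j else x

/-- A sorting network of permitted exchanges. -/
def normalize (x : Word) : Word :=
  [(0, 1), (2, 3), (0, 3), (1, 2), (2, 0), (3, 1), (0, 1), (2, 3), (0, 3), (1, 2)].foldl
    (fun y p => sort p.1 p.2 y) x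

/-- The letters of a word, counted with multiplicity. -/
def content (x : Word) : Fin 4 →₀ ℕ :=
  ∑ i, Finsupp.single (x i) 1

/-- The content of a word as the digits in base 5 of a number, for the sake of computation. -/
def code (x : Word) : ℕ :=
  5 ^ (x 0 : ℕ) + 5 ^ (x 1 : ℕ) + 5 ^ (x 2 : ℕ) + 5 ^ (x 3 : ℕ)

lemma code_eq_sum_content (x : Word) : x.code = x.content.sum fun k m => m * 5 ^ (k : ℕ) := by
  rw [content, ← Finsupp.sum_finsetSum_index (by simp) (by intros; ring), Fin.sum_univ_four]
  simp [code]

instance : DecidablePred Valid :=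
  fun x => inferInstanceAs (Decidable (∀ i, x i ≠ i))

lemma normalize_eq_of_code_eq : ∀ x : Word, x.Valid → ∀ y : Word, y.Valid →
    x.code = y.code → x.normalize = y.normalize := by
  decide +kernel

lemma normalize_eq_of_content_eq {x y : Word} (hx : x.Valid) (hy : y.Valid)
    (h : x.content = y.content) : x.normalize = y.normalize :=
  normalize_eq_of_code_eq x hx y hy (by rw [code_eq_sum_content, code_eq_sum_content, h])

end Word

end Words

section FourFoci

lemma exists_linearIndependent_last_eq {ι K V : Type*} [Field K] [AddCommGroup V] [Module K V]
    {r : ℕ} (hr : Module.finrank K V = r + 1) {v : ι → V} {s : Set ι}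
    (hs : Submodule.span K (v '' s) = ⊤) {a : ι} (ha : v a ≠ 0) :
    ∃ κ : Fin (r + 1) → ι, LinearIndependent K (v ∘ κ) ∧ κ (Fin.last r) = a ∧
      ∀ k : Fin r, κ k.castSucc ∈ s := by
  obtain ⟨b, hbs, hab, hspan, hb⟩ := exists_linearIndepOn_extension
    ((linearIndepOn_singleton_iff K).2 ha : LinearIndepOn K v {a})
    (Set.singleton_subset_iff.2 (Set.mem_insert a s))
  have hspan' : Submodule.span K (Set.range fun i : b => v i) = ⊤ := by
    refine top_unique (hs.ge.trans (Submodule.span_le.2 ?_))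
    rw [← Set.image_eq_range]
    exact (Set.image_mono (Set.subset_insert a s)).trans hspan
  have := Module.finite_of_finrank_eq_succ hr
  let B := Module.Basis.mk hb hspan'.ge
  have := Module.Finite.finite_basis B
  let := Fintype.ofFinite b
  have hcard : Fintype.card b = r + 1 := by rw [← hr, Module.finrank_eq_card_basis B]
  let e₀ := (Fintype.equivFinOfCardEq hcard).symm
  let a' : b := ⟨a, hab rfl⟩
  let e := (Equiv.swap (Fin.last r) (e₀.symm a')).trans e₀
  have hlast : e (Fin.last r) = a' := by simp [e]
  refine ⟨fun k => e k, hb.comp e e.injective, congrArg Subtype.val hlast, fun k => ?_⟩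
  refine (hbs (e k.castSucc).2).resolve_left fun hk => (Fin.castSucc_lt_last k).ne ?_
  exact e.injective (hlast ▸ Subtype.ext hk)

namespace TwoViewSystem

variable {ι K R : Type*} [Field K] [CommRing R] [Algebra K R] {S : TwoViewSystem ι K R}
  {κ : Fin 4 → ι} {G H : Matrix (Fin 4) (Fin 4) K}

/-- The product of the coordinate forms of a word; the coordinate forms are the rows of `G`. -/
def word (S : TwoViewSystem ι K R) (κ : Fin 4 → ι) (G : Matrix (Fin 4) (Fin 4) K) (x : Word) : R :=
  ∏ i, S.form (κ i) (G (x i))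

lemma row_dotProduct_focus (hGH : G * H = 1) (hcol : ∀ k, H.col k = S.focus (κ k)) {a k : Fin 4}
    (hak : a ≠ k) : G a ⬝ᵥ S.focus (κ k) = 0 := by
  rw [← hcol, dotProduct_col_of_mul_eq_one hGH, if_neg hak]

lemma mk_word_sort (hGH : G * H = 1) (hcol : ∀ k, H.col k = S.focus (κ k))
    (hκ : Function.Injective κ) {i j : Fin 4} (hij : i ≠ j) (x : Word) :
    Ideal.Quotient.mk S.relations (S.word κ G (x.sort i j)) =
      Ideal.Quotient.mk S.relations (S.word κ G x) := by
  rw [Word.sort]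
  split_ifs with hsort
  swap
  · rfl
  obtain ⟨-, hii, hij', hji, hjj⟩ := hsort
  have hsplit (y : Word) : S.word κ G y = S.form (κ i) (G (y i)) * S.form (κ j) (G (y j)) *
      ∏ l ∈ {i, j}ᶜ, S.form (κ l) (G (y l)) := by
    rw [word, ← Finset.prod_mul_prod_compl {i, j}, Finset.prod_pair hij]
  have hrest : ∏ l ∈ {i, j}ᶜ, S.form (κ l) (G ((x ∘ Equiv.swap i j) l)) =
      ∏ l ∈ {i, j}ᶜ, S.form (κ l) (G (x l)) := by
    refine Finset.prod_congr rfl fun l hl => ?_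
    simp only [Finset.mem_compl, Finset.mem_insert, Finset.mem_singleton, not_or] at hl
    rw [Function.comp_apply, Equiv.swap_apply_of_ne_of_ne hl.1 hl.2]
  rw [Ideal.Quotient.eq, hsplit, hsplit x, hrest, ← sub_mul]
  refine S.relations.mul_mem_right _ ?_
  rw [Function.comp_apply, Function.comp_apply, Equiv.swap_apply_left, Equiv.swap_apply_right]
  exact S.exchange_mem _ _ (hκ.ne hij) _ _ (row_dotProduct_focus hGH hcol hji)
    (row_dotProduct_focus hGH hcol hjj) (row_dotProduct_focus hGH hcol hii)
    (row_dotProduct_focus hGH hcol hij')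

lemma mk_word_normalize (hGH : G * H = 1) (hcol : ∀ k, H.col k = S.focus (κ k))
    (hκ : Function.Injective κ) (x : Word) :
    Ideal.Quotient.mk S.relations (S.word κ G x.normalize) =
      Ideal.Quotient.mk S.relations (S.word κ G x) := by
  simp only [Word.normalize, List.foldl_cons, List.foldl_nil]
  repeat rw [mk_word_sort hGH hcol hκ (by decide)]

lemma linSubst_generic_word (hGH : G * H = 1) (hcol : ∀ k, H.col k = S.focus (κ k)) {x : Word}
    (hx : x.Valid) : linSubst H (S.generic (S.word κ G x)) = monomial x.content 1 := by
  have hX (i) : linSubst H (S.generic (S.form (κ i) (G (x i)))) = X (x i) := by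
    rw [S.generic_form _ _ (row_dotProduct_focus hGH hcol (hx i)), ← linSubst_X,
      linSubst_linSubst_of_mul_eq_one hGH]
  simp only [word, map_prod, hX, Word.content, monomial_sum_one, X]

lemma multilinear_image_le_span_word [DecidableEq ι] (hGH : G * H = 1)
    (hcol : ∀ k, H.col k = S.focus (κ k)) (hκ : Function.Injective κ) :
    S.multilinear (Finset.univ.image κ) ≤
      Submodule.span K (S.word κ G '' {x | x.Valid}) := by
  refine Submodule.span_le.2 ?_
  rintro _ ⟨w, hw, rfl⟩
  have hexpand : ∏ i ∈ Finset.univ.image κ, S.form i (w i) =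
      ∑ x : Word, (∏ i, w (κ i) ⬝ᵥ H.col (x i)) • S.word κ G x := by
    have hform (i) : S.form (κ i) (w (κ i)) =
        ∑ a, (w (κ i) ⬝ᵥ H.col a) • S.form (κ i) (G a) := by
      conv_lhs => rw [eq_sum_dotProduct_col_smul hGH (w (κ i)), map_sum]
      simp only [map_smul]
    simp only [Finset.prod_image hκ.injOn, hform, Finset.prod_univ_sum, Finset.prod_smul,
      Fintype.piFinset_univ, word]
  rw [hexpand]
  refine Submodule.sum_mem _ fun x _ => ?_
  by_cases hx : x.Valid
  · exact Submodule.smul_mem _ _ (Submodule.subset_span ⟨x, hx, rfl⟩)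
  · obtain ⟨i, hi⟩ := not_forall_not.1 hx
    rw [Finset.prod_eq_zero (Finset.mem_univ i), zero_smul]
    · exact zero_mem _
    · rw [hi, hcol, hw _ (Finset.mem_image_of_mem κ (Finset.mem_univ i))]

theorem exact_image [DecidableEq ι] (hκ : LinearIndependent K (S.focus ∘ κ)) :
    S.Exact (Finset.univ.image κ) := by
  obtain ⟨G, H, hGH, hcol⟩ := exists_mul_eq_one_and_forall_col_eq hκ
  have hinj : Function.Injective κ := hκ.injective.of_comp
  have hfactors : Function.FactorsThrough
      (fun x : {x : Word // x.Valid} => Ideal.Quotient.mk S.relations (S.word κ G x))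
      (fun x => x.1.content) := fun x y hxy => by
    change Ideal.Quotient.mk _ _ = Ideal.Quotient.mk _ _
    rw [← mk_word_normalize hGH hcol hinj, ← mk_word_normalize hGH hcol hinj y.1,
      Word.normalize_eq_of_content_eq x.2 y.2 hxy]
  let Λ : MvPolynomial (Fin 4) K →ₗ[K] R ⧸ S.relations := (basisMonomials (Fin 4) K).constr K
    (Function.extend (fun x : {x : Word // x.Valid} => x.1.content)
      (fun x => Ideal.Quotient.mk S.relations (S.word κ G x)) 0)
  have hΛ (x : Word) (hx : x.Valid) : Λ (monomial x.content 1) =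
      Ideal.Quotient.mk S.relations (S.word κ G x) := by
    rw [← congrFun (coe_basisMonomials (Fin 4) K) x.content, Module.Basis.constr_basis]
    exact hfactors.extend_apply _ ⟨x, hx⟩
  have heq : Set.EqOn (Λ ∘ₗ (linSubst H).toLinearMap ∘ₗ S.generic.toLinearMap)
      (Ideal.Quotient.mkₐ K S.relations).toLinearMap (S.word κ G '' {x | x.Valid}) := by
    rintro _ ⟨x, hx, rfl⟩
    exact (congrArg Λ (linSubst_generic_word hGH hcol hx)).trans (hΛ x hx)
  intro F hF hgen
  rw [← Ideal.Quotient.eq_zero_iff_mem]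
  refine (LinearMap.eqOn_span heq (multilinear_image_le_span_word hGH hcol hinj hF)).symm.trans ?_
  simp [hgen]

lemma Exact.of_image_subset [DecidableEq ι] (hκ : LinearIndependent K (S.focus ∘ κ))
    {σ : Finset ι} (hσ : Finset.univ.image κ ⊆ σ) : S.Exact σ := by
  obtain ⟨τ, rfl⟩ : ∃ τ, σ = Finset.univ.image κ ∪ τ := ⟨σ, (Finset.union_eq_right.2 hσ).symm⟩
  clear hσ
  induction τ using Finset.induction_on with
  | empty => rw [Finset.union_empty]; exact exact_image hκ
  | insert a τ _ ih =>
    rw [Finset.union_insert]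
    set ρ := Finset.univ.image κ ∪ τ with hρ
    by_cases ha : a ∈ ρ
    · rwa [Finset.insert_eq_of_mem ha]
    have hspan : Submodule.span K (S.focus '' ρ) = ⊤ := by
      refine top_unique ((hκ.span_eq_top_of_card_eq_finrank' (by simp)).ge.trans
        (Submodule.span_mono ?_))
      rintro _ ⟨k, rfl⟩
      exact ⟨κ k, by simp [hρ], rfl⟩
    obtain ⟨κ', hκ', rfl, hmem⟩ := exists_linearIndependent_last_eq (r := 3) (by simp) hspan
      (S.focus_ne_zero a)
    exact ih.insert hκ' hmem ha

theorem exact_of_span_eq_top {σ : Finset ι}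
    (hσ : Submodule.span K (S.focus '' σ) = ⊤) : S.Exact σ := by
  classical
  obtain ⟨a, ha⟩ : σ.Nonempty := by
    rw [Finset.nonempty_iff_ne_empty]
    rintro rfl
    simp at hσ
  obtain ⟨κ, hκ, hlast, hmem⟩ := exists_linearIndependent_last_eq (r := 3) (by simp) hσ
    (S.focus_ne_zero a)
  refine Exact.of_image_subset hκ (Finset.image_subset_iff.2 fun k _ => ?_)
  exact Fin.lastCases (hlast ▸ ha) hmem k

end TwoViewSystem

end FourFoci

section StandardMonomials

lemma eval_eq_zero_of_mul {τ K : Type*} [Field K] [Infinite K] {Q : Submodule K (τ → K)}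
    {f g : MvPolynomial τ K} (hf : ∃ b ∈ Q, eval b f ≠ 0) (hfg : ∀ a ∈ Q, eval a (f * g) = 0)
    {a : τ → K} (ha : a ∈ Q) : eval a g = 0 := by
  obtain ⟨b, hb, hbf⟩ := hf
  let line : MvPolynomial τ K →ₐ[K] Polynomial K :=
    aeval fun y => Polynomial.C (a y) + Polynomial.X * Polynomial.C (b y - a y)
  have eval_line (t : K) (h : MvPolynomial τ K) :
      (line h).eval t = eval (a + t • (b - a)) h := by
    induction h using MvPolynomial.induction_on with
    | C c => simp [line]
    | add h₁ h₂ ih₁ ih₂ => simp only [map_add, Polynomial.eval_add, ih₁, ih₂]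
    | mul_X h y ih =>
      rw [map_mul, map_mul, Polynomial.eval_mul, ih]
      simp [line]
  have hline : line f * line g = 0 := Polynomial.funext fun t => by
    rw [← map_mul, eval_line, Polynomial.eval_zero]
    exact hfg _ (Q.add_mem ha (Q.smul_mem t (Q.sub_mem hb ha)))
  have hlinef : line f ≠ 0 := fun h => hbf (by
    rw [← add_sub_cancel a b, ← one_smul K (b - a), ← eval_line, h, Polynomial.eval_zero])
  simpa [(mul_eq_zero.1 hline).resolve_left hlinef] using (eval_line 0 g).symm

lemma exists_eq_X_mul_add {τ S : Type*} [CommRing S] (x : τ) (p : MvPolynomial τ S) :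
    ∃ g r, p = X x * g + r ∧ ∀ m ∈ r.support, m ∈ p.support ∧ m x = 0 := by
  refine ⟨p.divMonomial (Finsupp.single x 1), p.modMonomial (Finsupp.single x 1),
    (divMonomial_add_modMonomial_single p x).symm, fun m hm => ?_⟩
  rw [mem_support_iff] at hm
  have hle : ¬ Finsupp.single x 1 ≤ m := fun hle => hm (coeff_modMonomial_of_le _ hle)
  rw [coeff_modMonomial_of_not_le _ hle] at hm
  rw [Finsupp.single_le_iff] at hle
  exact ⟨mem_support_iff.2 hm, by omega⟩

/-- The degree of each of the groups of variables `(i, ·)`, as a weight. -/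
abbrev multidegree {ι κ : Type*} : (ι × κ →₀ ℕ) →+ (ι →₀ ℕ) :=
  Finsupp.weight fun x => Finsupp.single x.1 1

variable {ι κ K : Type*}

lemma multidegree_apply [Finite ι] [Fintype κ] (m : ι × κ →₀ ℕ) (i : ι) :
    multidegree m i = ∑ k, m (i, k) := by
  classical
  have := Fintype.ofFinite ι
  simp [multidegree, Finsupp.weight_eq_sum, Finsupp.finsetSum_apply, Fintype.sum_prod_type,
    Finsupp.single_apply]

lemma coeff_aeval_C_mul_X [CommRing K] (a : ι × κ → K)
    (p : MvPolynomial (ι × κ) K) (d : ι →₀ ℕ) :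
    coeff d (aeval (fun x => C (a x) * X x.1 : ι × κ → MvPolynomial ι K) p) =
      eval a (weightedHomogeneousComponent (fun x => Finsupp.single x.1 1) d p) := by
  classical
  induction p using MvPolynomial.induction_on' with
  | add p q hp hq => simp only [map_add, coeff_add, hp, hq]
  | monomial m c =>
    have hprod : (m.prod fun x n => (C (a x) * X x.1 : MvPolynomial ι K) ^ n) =
        monomial (multidegree m) (m.prod fun x n => a x ^ n) := by
      rw [multidegree, Finsupp.weight_apply, Finsupp.sum, Finsupp.prod, Finsupp.prod,
        monomial_sum_prod]
      exact Finset.prod_congr rfl fun x _ => by rw [C_mul_X_eq_monomial, monomial_pow]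
    rw [aeval_monomial, hprod, algebraMap_eq, C_mul_monomial, coeff_monomial]
    split_ifs with h
    · rw [weightedHomogeneousComponent_eq_self (isWeightedHomogeneous_monomial _ _ _ h),
        eval_monomial]
    · rw [(isWeightedHomogeneous_monomial _ _ _ rfl).weightedHomogeneousComponent_ne _ (Ne.symm h),
        map_zero]

lemma isWeightedHomogeneous_of_X_mul {τ M : Type*} [AddCommMonoid M] [IsLeftCancelAdd M]
    [CommRing K] {w : τ → M} {x : τ} {p : MvPolynomial τ K} {d : M}
    (h : IsWeightedHomogeneous w (X x * p) (w x + d)) : IsWeightedHomogeneous w p d := by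
  intro m hm
  rw [← coeff_X_mul m x] at hm
  have hadd := h hm
  rwa [map_add, Finsupp.weight_single, one_smul, add_left_cancel_iff] at hadd

lemma eq_C_of_isWeightedHomogeneous_zero [Finite ι] [Finite κ] [CommRing K]
    {p : MvPolynomial (ι × κ) K}
    (hp : IsWeightedHomogeneous (fun x => Finsupp.single x.1 1 : ι × κ → ι →₀ ℕ) p 0) :
    p = C (coeff 0 p) := by
  classical
  have := Fintype.ofFinite κ
  ext m
  rw [coeff_C]
  split_ifs with h
  · rw [h]
  · refine hp.coeff_eq_zero m fun hm => h (Finsupp.ext fun x => ?_).symm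
    have hsum := multidegree_apply m x.1
    rw [multidegree, hm, Finsupp.zero_apply] at hsum
    exact (Finset.sum_eq_zero_iff.1 hsum.symm x.2 (Finset.mem_univ _))

variable [Fintype ι]

/-- The variables `(i, k)` with `k < s i`. -/
def staircase (s : ι → ℕ) : Finset (ι × Fin 3) := {x | (x.2 : ℕ) < s x.1}

lemma mem_staircase {s : ι → ℕ} {x : ι × Fin 3} : x ∈ staircase s ↔ (x.2 : ℕ) < s x.1 := by
  simp [staircase]

lemma card_staircase_le (s : ι → ℕ) : (staircase s).card ≤ ∑ i, s i := by
  rw [staircase, Finset.card_filter, Fintype.sum_prod_type]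
  refine Finset.sum_le_sum fun i _ => ?_
  simp only [Fin.sum_univ_three]
  split_ifs <;> simp_all <;> omega

/-- The monomials that become standard, i.e. have indices of leading variables adding up to at most
three, when the variables `(i, k)` with `k < s i` are set to zero: those in the variables `(i, k)`
with `s i ≤ k ≤ e i` for some `e` of sum at most three. -/
def IsStandardOver (s : ι → ℕ) (m : ι × Fin 3 →₀ ℕ) : Prop :=
  ∃ e : ι → ℕ, s ≤ e ∧ ∑ i, e i ≤ 3 ∧ ∀ x, m x ≠ 0 → s x.1 ≤ x.2 ∧ (x.2 : ℕ) ≤ e x.1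

lemma IsStandardOver.of_le {s : ι → ℕ} {m m' : ι × Fin 3 →₀ ℕ} (hm : IsStandardOver s m)
    (h : m' ≤ m) : IsStandardOver s m' := by
  obtain ⟨e, hse, he, hme⟩ := hm
  exact ⟨e, hse, he, fun x hx => hme x fun hmx => hx (Nat.le_zero.1 (hmx ▸ h x))⟩

lemma IsStandardOver.sum_le {s : ι → ℕ} {m : ι × Fin 3 →₀ ℕ} (hm : IsStandardOver s m) :
    ∑ i, s i ≤ 3 := by
  obtain ⟨e, hse, he, -⟩ := hm
  exact (Finset.sum_le_sum fun i _ => hse i).trans he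

lemma IsStandardOver.add_single [DecidableEq ι] {s : ι → ℕ} {m : ι × Fin 3 →₀ ℕ}
    (hm : IsStandardOver s m) {x : ι × Fin 3} (hx : (x.2 : ℕ) = s x.1) (hmx : m x = 0) {k : Fin 3}
    (hk : m (x.1, k) ≠ 0) : IsStandardOver (s + Pi.single x.1 1) m := by
  obtain ⟨e, hse, he, hme⟩ := hm
  have hlt : ∀ l : Fin 3, m (x.1, l) ≠ 0 → s x.1 < l := fun l hl =>
    (hme _ hl).1.lt_of_ne fun h => hl (by
      rwa [show l = x.2 from Fin.ext (h.symm.trans hx.symm)])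
  refine ⟨e, fun i => ?_, he, fun y hy => ⟨?_, (hme y hy).2⟩⟩
  · by_cases hi : i = x.1
    · subst hi
      simpa using (hlt k hk).trans_le (hme _ hk).2
    · simpa [hi] using hse i
  · obtain ⟨i, l⟩ := y
    by_cases hi : i = x.1
    · subst hi
      simpa using hlt l hy
    · simpa [hi] using (hme _ hy).1

lemma exists_next_variable {K : Type*} [CommRing K] {s : ι → ℕ} {d : ι →₀ ℕ}
    {p : MvPolynomial (ι × Fin 3) K}
    (hd : IsWeightedHomogeneous (fun x => Finsupp.single x.1 1 : ι × Fin 3 → ι →₀ ℕ) p d)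
    (hs : ∀ m ∈ p.support, IsStandardOver s m) (hp0 : p ≠ 0) (hd0 : d ≠ 0) :
    ∃ x : ι × Fin 3, ∃ d', (x.2 : ℕ) = s x.1 ∧ d = Finsupp.single x.1 1 + d' ∧
      ∀ m ∈ p.support, ∃ k, m (x.1, k) ≠ 0 := by
  classical
  obtain ⟨i, hi⟩ := Finsupp.ne_iff.1 hd0
  obtain ⟨d', hd'⟩ : ∃ d', d = Finsupp.single i 1 + d' :=
    le_iff_exists_add.1 (Finsupp.single_le_iff.2 (Nat.one_le_iff_ne_zero.2 hi))
  have exists_ne_zero : ∀ m ∈ p.support, ∃ k, m (i, k) ≠ 0 := fun m hm => by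
    have hsum := multidegree_apply m i
    rw [multidegree, hd (mem_support_iff.1 hm)] at hsum
    obtain ⟨k, -, hk⟩ := Finset.exists_ne_zero_of_sum_ne_zero (hsum ▸ hi)
    exact ⟨k, hk⟩
  obtain ⟨m, hm⟩ := support_nonempty.2 hp0
  obtain ⟨k, hk⟩ := exists_ne_zero m hm
  obtain ⟨e, -, -, he⟩ := hs m hm
  exact ⟨(i, ⟨s i, (he _ hk).1.trans_lt k.2⟩), d', rfl, hd', exists_ne_zero⟩

variable [Field K] [Infinite K]

theorem eq_zero_of_isStandardOver {Q : Submodule K (ι × Fin 3 → K)}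
    (hQ : ∀ T : Finset (ι × Fin 3), T.card ≤ 3 → ∀ x ∉ T, ∃ a ∈ Q, (∀ y ∈ T, a y = 0) ∧ a x ≠ 0)
    {s : ι → ℕ} {d : ι →₀ ℕ} {p : MvPolynomial (ι × Fin 3) K}
    (hd : IsWeightedHomogeneous (fun x => Finsupp.single x.1 1 : ι × Fin 3 → ι →₀ ℕ) p d)
    (hs : ∀ m ∈ p.support, IsStandardOver s m)
    (hp : ∀ a ∈ Q ⊓ Submodule.pi (staircase s) fun _ => ⊥, eval a p = 0) : p = 0 := by
  classical
  induction hN : d.degree + ∑ i, (3 - s i) using Nat.strong_induction_on generalizing s d p with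
  | _ N ih =>
  subst hN
  by_contra hp0
  rcases eq_or_ne d 0 with rfl | hd0
  · have hC := eq_C_of_isWeightedHomogeneous_zero hd
    have h0 := hp 0 (zero_mem _)
    rw [hC, eval_C] at h0
    exact hp0 (by rw [hC, h0, C_0])
  obtain ⟨x, d', hx, rfl, exists_ne_zero⟩ := exists_next_variable hd hs hp0 hd0
  obtain ⟨g, r, rfl, hr⟩ := exists_eq_X_mul_add x p
  -- Only `r` survives at points with `x`-coordinate zero; once it is gone, `X x` can be cancelled.
  have hr0 : r = 0 := by
    refine ih _ ?_ (s := s + Pi.single x.1 1) (d := Finsupp.single x.1 1 + d')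
      (fun m hm => hd (mem_support_iff.1 (hr m (mem_support_iff.2 hm)).1))
      (fun m hm => ?_) (fun a ha => ?_) rfl
    · refine Nat.add_lt_add_left (Finset.sum_lt_sum (fun j _ => ?_) ⟨x.1, Finset.mem_univ _, ?_⟩) _
      · exact Nat.sub_le_sub_left (by simp) _
      · rw [Pi.add_apply, Pi.single_eq_same]
        omega
    · obtain ⟨k, hk⟩ := exists_ne_zero m (hr m hm).1
      exact (hs m (hr m hm).1).add_single hx (hr m hm).2 hk
    · have hax : a x = 0 := ha.2 x (mem_staircase.2 (by simp [hx]))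
      have heval := hp a ⟨ha.1, fun y hy => ha.2 y
        (mem_staircase.2 ((mem_staircase.1 hy).trans_le (by simp)))⟩
      simpa [hax] using heval
  rw [hr0, add_zero] at hd hs hp hp0
  obtain ⟨m₀, hm₀⟩ := support_nonempty.2 hp0
  obtain ⟨b, hbQ, hbs, hbx⟩ := hQ (staircase s)
    ((card_staircase_le s).trans (hs m₀ hm₀).sum_le) x (by simp [mem_staircase, hx])
  have hb : b ∈ Q ⊓ Submodule.pi (staircase s) fun _ => ⊥ := ⟨hbQ, fun y hy => hbs y hy⟩
  have hdg : IsWeightedHomogeneous (fun x => Finsupp.single x.1 1 : ι × Fin 3 → ι →₀ ℕ) g d' :=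
    isWeightedHomogeneous_of_X_mul (x := x) hd
  have hg0 : g = 0 := by
    refine ih (d'.degree + ∑ i, (3 - s i)) (by simp) hdg (fun m hm => ?_) (fun a ha => ?_) rfl
    · have hm' : Finsupp.single x 1 + m ∈ (X x * g).support := by
        rwa [mem_support_iff, coeff_X_mul, ← mem_support_iff]
      exact (hs _ hm').of_le le_add_self
    · exact eval_eq_zero_of_mul ⟨b, hb, by rwa [eval_X]⟩ hp ha
  exact hp0 (by rw [hg0, mul_zero])

theorem eq_zero_of_isStandard {Q : Submodule K (ι × Fin 3 → K)}
    (hQ : ∀ T : Finset (ι × Fin 3), T.card ≤ 3 → ∀ x ∉ T, ∃ a ∈ Q, (∀ y ∈ T, a y = 0) ∧ a x ≠ 0)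
    {p : MvPolynomial (ι × Fin 3) K} (hs : ∀ m ∈ p.support, IsStandardOver 0 m)
    (hp : ∀ a ∈ Q, ∀ t : ι → K, eval (fun x => t x.1 * a x) p = 0) : p = 0 := by
  classical
  have hcomp (d : ι →₀ ℕ) : weightedHomogeneousComponent
      (fun x : ι × Fin 3 => Finsupp.single x.1 1) d p = 0 := by
    refine eq_zero_of_isStandardOver hQ (s := 0)
      (weightedHomogeneousComponent_isWeightedHomogeneous d p) (fun m hm => hs m ?_) fun a ha => ?_
    · rw [support_weightedHomogeneousComponent] at hm
      exact (Finset.mem_filter.1 hm).1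
    · have hscaled : aeval (fun x => C (a x) * X x.1 : ι × Fin 3 → MvPolynomial ι K) p = 0 :=
        MvPolynomial.funext fun t => by
          rw [map_zero, ← hp a ha.1 t, ← coe_aeval_eq_eval, ← coe_aeval_eq_eval, RingHom.coe_coe,
            RingHom.coe_coe, ← AlgHom.comp_apply, comp_aeval]
          simp [mul_comm]
      rw [← coeff_aeval_C_mul_X, hscaled, coeff_zero]
  ext m
  have hm := congrArg (coeff m) (hcomp (multidegree m))
  rwa [coeff_weightedHomogeneousComponent, if_pos rfl] at hm

end StandardMonomials

section GeneralPosition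

/-- Any `dim V` of the vectors are linearly independent. -/
def InGeneralPosition (K : Type*) {V τ : Type*} [Field K] [AddCommGroup V] [Module K V]
    (L : τ → V) : Prop :=
  ∀ T : Finset τ, T.card ≤ Module.finrank K V → LinearIndepOn K L T

lemma InGeneralPosition.comp {K V τ τ' : Type*} [Field K] [AddCommGroup V] [Module K V]
    {L : τ → V} (hL : InGeneralPosition K L) {e : τ' → τ} (he : Function.Injective e) :
    InGeneralPosition K (L ∘ e) := by
  classical
  intro T hT
  have himage := hL (T.image e) (Finset.card_image_le.trans hT)
  rw [Finset.coe_image] at himage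
  exact himage.comp_of_image he.injOn

variable {K τ : Type*} [Field K] {n : ℕ}

lemma InGeneralPosition.exists_sum_smul_eq {V : Type*} [AddCommGroup V] [Module K V]
    [FiniteDimensional K V] [Fintype τ] {L : τ → V} (hL : InGeneralPosition K L) {T : Finset τ}
    (hT : T.card = Module.finrank K V) (v : V) :
    ∃ c : τ → K, (∀ x ∉ T, c x = 0) ∧ v = ∑ x, c x • L x := by
  classical
  have hspan : Submodule.span K (L '' T) = ⊤ := by
    rw [Set.image_eq_range]
    exact (hL T hT.le).linearIndependent.span_eq_top_of_card_eq_finrank' (by simpa using hT)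
  have hv : v ∈ Submodule.span K (L '' T) := hspan ▸ Submodule.mem_top
  obtain ⟨c, rfl⟩ := Submodule.mem_span_image_finset_iff_exists_fun' K |>.1 hv
  exact ⟨fun x => if x ∈ T then c x else 0, fun x hx => if_neg hx, by simp [ite_smul]⟩

lemma InGeneralPosition.exists_mem_range {L : τ → Fin n → K} (hL : InGeneralPosition K L)
    {T : Finset τ} (hT : T.card < n) {x : τ} (hx : x ∉ T) :
    ∃ a ∈ LinearMap.range (Matrix.of L).mulVecLin, (∀ y ∈ T, a y = 0) ∧ a x ≠ 0 := by
  classical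
  have hind := hL (insert x T) (by rwa [Finset.card_insert_of_notMem hx, Module.finrank_fin_fun])
  rw [Finset.coe_insert] at hind
  obtain ⟨q, hq, hqx⟩ := exists_dotProduct_eq_zero_and_ne_zero (hind.notMem_span_of_insert hx)
  refine ⟨fun y => L y ⬝ᵥ q, ⟨q, rfl⟩, fun y hy => ?_, fun h =>
    hqx ((dotProduct_comm _ _).trans h)⟩
  exact (dotProduct_comm _ _).trans (hq _ (Submodule.subset_span (Set.mem_image_of_mem L hy)))

lemma finrank_ker_dotProductEquiv {f : Fin (n + 1) → K} (hf : f ≠ 0) :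
    Module.finrank K (LinearMap.ker (dotProductEquiv K _ f)) = n := by
  have hrank := Module.Dual.finrank_ker_add_one_of_ne_zero (f := dotProductEquiv K _ f) (by simpa)
  simpa using hrank

lemma exists_mem_forall_notMem {α V : Type*} [Finite α] [Infinite K] [AddCommGroup V] [Module K V]
    {W : Submodule K V} {N : α → Submodule K V} (h : ∀ a, ¬ W ≤ N a) :
    ∃ v ∈ W, ∀ a, v ∉ N a := by
  by_contra! hcover
  obtain ⟨a, ha⟩ := Subspace.exists_eq_top_of_iUnion_eq_univ
    (p := fun a => (N a).comap W.subtype) (Set.eq_univ_of_forall fun v => by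
      simpa using hcover v v.2)
  exact h a (Submodule.comap_subtype_eq_top.1 ha)

variable {ι : Type*} {f : ι → Fin (n + 1) → K}

lemma ker_dotProductEquiv_not_le {i j : ι} (h : f j ∉ Submodule.span K {f i}) :
    ¬ LinearMap.ker (dotProductEquiv K _ (f i)) ≤ LinearMap.ker (dotProductEquiv K _ (f j)) := by
  obtain ⟨w, hwi, hwj⟩ := exists_dotProduct_eq_zero_and_ne_zero h
  intro hle
  have hw := hle (x := w) (by
    simpa [dotProduct_comm] using hwi _ (Submodule.mem_span_singleton_self _))
  exact hwj (by simpa [dotProduct_comm] using hw)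

lemma mem_of_ker_dotProductEquiv_le_span (h0 : ∀ i, f i ≠ 0) {L : ι × Fin n → Fin (n + 1) → K}
    {i : ι} {A : Finset (ι × Fin n)} (hA : A.card ≤ n)
    (hL : ∀ x ∈ A, ∀ j, j ≠ x.1 → L x ⬝ᵥ f j ≠ 0)
    (hle : LinearMap.ker (dotProductEquiv K _ (f i)) ≤ Submodule.span K (L '' A)) (k : Fin n) :
    (i, k) ∈ A := by
  classical
  have hspan : Module.finrank K (Submodule.span K (L '' A)) ≤ A.card := by
    rw [← Finset.coe_image]
    exact (finrank_span_finset_le_card _).trans Finset.card_image_le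
  have hker := finrank_ker_dotProductEquiv (h0 i)
  have heq := Submodule.eq_of_le_of_finrank_le hle (by rw [hker]; exact hspan.trans hA)
  have hcard : n ≤ A.card := by rwa [← heq, hker] at hspan
  have hsub : A ⊆ Finset.univ.map (.sectR i (Fin n)) := fun x hx => by
    have hxi : L x ⬝ᵥ f i = 0 := by
      have hLx := heq.ge (Submodule.subset_span (Set.mem_image_of_mem L hx))
      simpa [dotProduct_comm] using hLx
    have hi : x.1 = i := by
      by_contra hne
      exact hL x hx i (Ne.symm hne) hxi
    exact Finset.mem_map.2 ⟨x.2, Finset.mem_univ _, by rw [← hi]; rfl⟩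
  rw [Finset.eq_of_subset_of_card_le hsub (by simpa using hcard)]
  simp

variable [Infinite K]

/-- Each new vector avoids finitely many proper subspaces of the hyperplane orthogonal to its
point. -/
lemma exists_inGeneralPosition_on [Finite ι] (h0 : ∀ i, f i ≠ 0)
    (hsep : ∀ i j, i ≠ j → f i ∉ Submodule.span K {f j}) (U : Finset (ι × Fin n)) :
    ∃ L : ι × Fin n → Fin (n + 1) → K,
      (∀ x ∈ U, L x ⬝ᵥ f x.1 = 0 ∧ ∀ j, j ≠ x.1 → L x ⬝ᵥ f j ≠ 0) ∧
      ∀ T ⊆ U, T.card ≤ n + 1 → LinearIndepOn K L (T : Set (ι × Fin n)) := by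
  classical
  induction U using Finset.induction_on with
  | empty => exact ⟨0, by simp, fun T hT _ => by simp [Finset.subset_empty.1 hT]⟩
  | insert x U hxU ih =>
    obtain ⟨L, hL, hind⟩ := ih
    obtain ⟨v, hv, hvN⟩ := exists_mem_forall_notMem
      (W := LinearMap.ker (dotProductEquiv K _ (f x.1)))
      (N := Sum.elim (fun j : {j // j ≠ x.1} => LinearMap.ker (dotProductEquiv K _ (f j)))
        fun A : {A : Finset (ι × Fin n) // A ⊆ U ∧ A.card ≤ n} => Submodule.span K (L '' A.1)) (by
      rintro (⟨j, hj⟩ | ⟨A, hAU, hA⟩)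
      · exact ker_dotProductEquiv_not_le (hsep _ _ hj)
      · exact fun hle => hxU (hAU (mem_of_ker_dotProductEquiv_le_span h0 hA
          (fun y hy => (hL y (hAU hy)).2) hle x.2)))
    refine ⟨Function.update L x v, fun y hy => ?_, fun T hT hcard => ?_⟩
    · rcases Finset.mem_insert.1 hy with rfl | hyU
      · rw [Function.update_self]
        exact ⟨by simpa [dotProduct_comm] using hv, fun j hj => by
          simpa [dotProduct_comm] using hvN (.inl ⟨j, hj⟩)⟩
      · rw [Function.update_of_ne (ne_of_mem_of_not_mem hyU hxU)]
        exact hL y hyU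
    · have hTU : T.erase x ⊆ U := by rwa [← Finset.subset_insert_iff]
      have hcongr : Set.EqOn L (Function.update L x v) (T.erase x : Finset _) := fun y hy =>
        (Function.update_of_ne (Finset.ne_of_mem_erase hy) _ _).symm
      have herase := (hind _ hTU (Finset.card_erase_le.trans hcard)).congr hcongr
      by_cases hxT : x ∈ T
      · rw [← Finset.insert_erase hxT, Finset.coe_insert]
        refine herase.insert ?_
        rw [← hcongr.image_eq, Function.update_self]
        exact hvN (.inr ⟨T.erase x, hTU, by rw [Finset.card_erase_of_mem hxT]; omega⟩)
      · rwa [Finset.erase_eq_of_notMem hxT] at herase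

theorem exists_inGeneralPosition [Finite ι] (h0 : ∀ i, f i ≠ 0)
    (hsep : ∀ i j, i ≠ j → f i ∉ Submodule.span K {f j}) :
    ∃ L : ι × Fin n → Fin (n + 1) → K, (∀ x, L x ⬝ᵥ f x.1 = 0) ∧ InGeneralPosition K L := by
  have := Fintype.ofFinite ι
  obtain ⟨L, hL, hind⟩ := exists_inGeneralPosition_on h0 hsep Finset.univ
  exact ⟨L, fun x => (hL x (Finset.mem_univ x)).1, fun T hT =>
    hind T (Finset.subset_univ T) (by simpa using hT)⟩

end GeneralPosition

lemma det_sum_smul {ι κ K R : Type*} [Fintype ι] [DecidableEq ι] [Fintype κ] [CommRing K]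
    [CommRing R] [Algebra K R] (B : ι → ι → κ → K) (x : ι → κ → R) :
    (Matrix.of fun i j => ∑ k, B i j k • x j k).det =
      ∑ k : ι → κ, (Matrix.of fun i j => B i j (k j)).det • ∏ j, x j (k j) := by
  simp only [det_apply', of_apply, Finset.prod_univ_sum, Fintype.piFinset_univ, Finset.mul_sum,
    Finset.sum_smul]
  rw [Finset.sum_comm]
  refine Finset.sum_congr rfl fun k _ => Finset.sum_congr rfl fun π _ => ?_
  rw [Finset.prod_smul, mul_smul_comm, ← zsmul_eq_mul, ← Int.cast_smul_eq_zsmul K, smul_smul,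
    mul_comm]

section LeadingTerms

variable {ι K : Type*} [Fintype ι]

lemma exists_card_eq_and_lt {N : ℕ} {e : ι → Fin 3} (he : N ≤ ∑ i, (e i : ℕ)) :
    ∃ T : Finset (ι × Fin 3), T.card = N ∧ ∀ x ∈ T, x.2 < e x.1 := by
  have hcard : N ≤ (Finset.univ.filter fun x : ι × Fin 3 => x.2 < e x.1).card := by
    rw [Finset.card_filter, Fintype.sum_prod_type]
    simpa only [← Finset.card_filter, Finset.filter_gt_eq_Iio, Fin.card_Iio] using he
  obtain ⟨T, hT, hTcard⟩ := Finset.exists_subset_card_eq hcard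
  exact ⟨T, hTcard, fun x hx => (Finset.mem_filter.1 (hT hx)).2⟩

/-- The relation is the determinant of a matrix with zero row sums, whose rows express each form
`L (i, e i)` through four forms of smaller index. -/
lemma exists_sum_prod_linearForm_eq_zero [DecidableEq ι] [Field K] {L : ι × Fin 3 → Fin 4 → K}
    (hL : InGeneralPosition K L) {e : ι → Fin 3} (he : 4 ≤ ∑ i, (e i : ℕ)) :
    ∃ c : (ι → Fin 3) → K, c e = 1 ∧ (∀ k, c k ≠ 0 → k ≤ e) ∧
      ∑ k, c k • ∏ j, linearForm (L (j, k j)) = 0 := by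
  obtain ⟨T, hT, hTe⟩ := exists_card_eq_and_lt he
  choose b hb hLb using fun i => hL.exists_sum_smul_eq (by simpa using hT) (L (i, e i))
  let B : ι → ι → Fin 3 → K := fun i j k => (if (j, k) = (i, e i) then 1 else 0) - b i (j, k)
  have hB (i j : ι) (k : Fin 3) (hk : e j ≤ k) : B i j k = if (j, k) = (i, e i) then 1 else 0 := by
    rw [show B i j k = _ - b i (j, k) from rfl, hb, sub_zero]
    exact fun hmem => hk.not_gt (hTe _ hmem)
  refine ⟨fun k => (Matrix.of fun i j => B i j (k j)).det, ?_, fun k hk j => ?_, ?_⟩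
  · have hone : (Matrix.of fun i j => B i j (e j)) = 1 := by
      ext i j
      rw [of_apply, hB i j _ le_rfl, one_apply]
      refine if_congr ⟨fun h => (Prod.mk.inj h).1.symm, ?_⟩ rfl rfl
      rintro rfl
      rfl
    simp only [hone, det_one]
  · by_contra! hlt
    refine hk (det_eq_zero_of_column_eq_zero j fun i => ?_)
    rw [of_apply, hB i j _ hlt.le, if_neg]
    intro h
    obtain ⟨rfl, h⟩ := Prod.mk.inj h
    exact hlt.ne' h
  · have hrow (i : ι) : ∑ x : ι × Fin 3, B i x.1 x.2 • linearForm (L x) = 0 := by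
      simp only [B, sub_smul, Finset.sum_sub_distrib, ite_smul, one_smul, zero_smul,
        Finset.sum_ite_eq', Finset.mem_univ, if_true, Prod.mk.eta, ← map_smul, ← map_sum, ← hLb,
        sub_self, map_zero]
    rw [← det_sum_smul B fun j k => linearForm (L (j, k)), ← exists_mulVec_eq_zero_iff]
    refine ⟨1, ?_, funext fun i => ?_⟩
    · obtain ⟨x, -⟩ := Finset.card_pos.1 (by rw [hT]; exact Nat.succ_pos 3 : 0 < T.card)
      exact fun h => one_ne_zero (congrFun h x.1)
    · rw [mulVec, dotProduct_one, Pi.zero_apply, ← hrow i, Fintype.sum_prod_type]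
      rfl

end LeadingTerms

lemma exists_leading_indices {ι : Type*} (m : ι × Fin 3 →₀ ℕ) :
    ∃ e : ι → Fin 3, (∀ x, m x ≠ 0 → x.2 ≤ e x.1) ∧ ∀ i, e i ≠ 0 → m (i, e i) ≠ 0 := by
  let indices (i : ι) : Finset (Fin 3) := {k | m (i, k) ≠ 0}
  refine ⟨fun i => (indices i).sup id, fun x hx =>
    Finset.le_sup (f := id) (by simpa [indices] using hx), fun i hi => ?_⟩
  have hne : (indices i).Nonempty := by
    rw [Finset.nonempty_iff_ne_empty]
    exact fun h => hi (by simp only [h]; rfl)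
  obtain ⟨k, hk, hsup⟩ := Finset.exists_mem_eq_sup _ hne id
  beta_reduce
  rw [hsup]
  exact (Finset.mem_filter.1 hk).2

lemma prod_mul_prod_eq_of_eq_off {ι M : Type*} [Fintype ι] [CommMonoid M]
    {A : Finset ι} {f g : ι → M} (h : ∀ i ∉ A, f i = g i) :
    (∏ i, g i) * ∏ i ∈ A, f i = (∏ i, f i) * ∏ i ∈ A, g i := by
  classical
  rw [← Finset.prod_mul_prod_compl A f, ← Finset.prod_mul_prod_compl A g,
    Finset.prod_congr rfl fun i hi => h i (Finset.mem_compl.1 hi)]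
  ac_rfl

lemma sum_single_le {ι κ : Type*} {A : Finset ι} {e : ι → κ} {m : ι × κ →₀ ℕ}
    (h : ∀ i ∈ A, m (i, e i) ≠ 0) : ∑ i ∈ A, Finsupp.single (i, e i) 1 ≤ m := by
  classical
  rintro ⟨j, k⟩
  have hcoord : (∑ i ∈ A, Finsupp.single (i, e i) 1 : ι × κ →₀ ℕ) (j, k) =
      if j ∈ A then if e j = k then 1 else 0 else 0 := by
    rw [Finsupp.finsetSum_apply, ← Finset.sum_ite_eq' A j fun j => if e j = k then 1 else 0]
    refine Finset.sum_congr rfl fun i _ => ?_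
    by_cases hi : i = j
    · simp [hi, Finsupp.single_apply]
    · simp [hi]
  rw [hcoord]
  split_ifs with hj hk
  · exact Nat.one_le_iff_ne_zero.2 (hk ▸ h j hj)
  · exact Nat.zero_le _
  · exact Nat.zero_le _

/-- The weight of a monomial when the variable `(i, k)` has weight `k`. -/
abbrev indexWeight {ι : Type*} : (ι × Fin 3 →₀ ℕ) →+ ℕ := Finsupp.weight fun x => (x.2 : ℕ)

lemma indexWeight_sum_single_lt {ι : Type*} {A : Finset ι} {k e : ι → Fin 3} (hle : k ≤ e)
    (hne : k ≠ e) (hA : ∀ i ∉ A, e i = 0) :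
    indexWeight (∑ i ∈ A, Finsupp.single (i, k i) 1) <
      indexWeight (∑ i ∈ A, Finsupp.single (i, e i) 1) := by
  obtain ⟨i, hi⟩ := Function.ne_iff.1 hne
  have hlt := (hle i).lt_of_ne hi
  have hiA : i ∈ A := by
    by_contra h
    exact (Fin.not_lt_zero _) (hA i h ▸ hlt)
  simp only [indexWeight, map_sum, Finsupp.weight_single, one_smul]
  exact Finset.sum_lt_sum (fun j _ => hle j) ⟨i, hiA, hlt⟩

namespace TwoViewSystem

variable {ι K R : Type*} [Field K] [CommRing R] [Algebra K R] {S : TwoViewSystem ι K R}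
  {L : ι × Fin 3 → Fin 4 → K}

/-- The substitution of the forms `L x` on the image planes for independent variables. -/
def substForms (S : TwoViewSystem ι K R) (L : ι × Fin 3 → Fin 4 → K) :
    MvPolynomial (ι × Fin 3) K →ₐ[K] R :=
  aeval fun x => S.form x.1 (L x)

lemma substForms_monomial_sum_single (A : Finset ι) (k : ι → Fin 3) :
    S.substForms L (monomial (∑ i ∈ A, Finsupp.single (i, k i) 1) 1) =
      ∏ i ∈ A, S.form i (L (i, k i)) := by
  rw [monomial_sum_one, map_prod]
  exact Finset.prod_congr rfl fun i _ => aeval_X _ _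

variable [Fintype ι]

lemma exists_sum_prod_form_mem [DecidableEq ι] (hex : S.Exact Finset.univ)
    (hL : InGeneralPosition K L) (hLf : ∀ x, L x ⬝ᵥ S.focus x.1 = 0) {e : ι → Fin 3}
    (he : 4 ≤ ∑ i, (e i : ℕ)) :
    ∃ c : (ι → Fin 3) → K, c e = 1 ∧ (∀ k, c k ≠ 0 → k ≤ e) ∧
      ∑ k, c k • ∏ j, S.form j (L (j, k j)) ∈ S.relations := by
  obtain ⟨c, hce, hc, hsum⟩ := exists_sum_prod_linearForm_eq_zero hL he
  refine ⟨c, hce, hc, hex _ (Submodule.sum_mem _ fun k _ => Submodule.smul_mem _ _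
    (Submodule.subset_span ⟨fun j => L (j, k j), fun j _ => hLf _, rfl⟩)) ?_⟩
  rw [map_sum, ← hsum]
  refine Finset.sum_congr rfl fun k _ => ?_
  rw [map_smul, map_prod]
  exact congrArg _ (Finset.prod_congr rfl fun j _ => S.generic_form _ _ (hLf _))

lemma prod_mul_substForms_monomial {A : Finset ι} {k : ι → Fin 3} (hk : ∀ i ∉ A, k i = 0)
    (m : ι × Fin 3 →₀ ℕ) :
    (∏ i, S.form i (L (i, 0))) *
        S.substForms L (monomial (m + ∑ i ∈ A, Finsupp.single (i, k i) 1) 1) =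
      (∏ i, S.form i (L (i, k i))) *
        ((∏ i ∈ A, S.form i (L (i, 0))) * S.substForms L (monomial m 1)) := by
  have heq : ∀ i ∉ A, S.form i (L (i, k i)) = S.form i (L (i, 0)) := fun i hi => by rw [hk i hi]
  rw [← one_mul (1 : K), ← monomial_mul, map_mul, substForms_monomial_sum_single, one_mul,
    mul_left_comm, prod_mul_prod_eq_of_eq_off heq]
  ring

/-- The reduction step: up to the factors `form i (L (i, 0))`, a nonstandard monomial is divisible
by the leading monomial of a relation. -/
lemma exists_prod_mul_substForms_mem (hex : S.Exact Finset.univ) (hL : InGeneralPosition K L)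
    (hLf : ∀ x, L x ⬝ᵥ S.focus x.1 = 0) {m : ι × Fin 3 →₀ ℕ} (hm : ¬ IsStandardOver 0 m) :
    ∃ g ∈ restrictSupport K {m' | indexWeight m' < indexWeight m},
      (∏ i, S.form i (L (i, 0))) * S.substForms L (monomial m 1 + g) ∈ S.relations := by
  classical
  obtain ⟨e, hme, hem⟩ := exists_leading_indices m
  have he : 4 ≤ ∑ i, (e i : ℕ) := by
    by_contra! hlt
    exact hm ⟨fun i => e i, fun i => Nat.zero_le _, Nat.le_of_lt_succ hlt, fun x hx =>
      ⟨Nat.zero_le _, hme x hx⟩⟩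
  obtain ⟨c, hce, hc, hrel⟩ := exists_sum_prod_form_mem hex hL hLf he
  let A : Finset ι := {i | e i ≠ 0}
  have hA : ∀ i ∉ A, e i = 0 := fun i hi => by simpa [A] using hi
  let u (k : ι → Fin 3) : ι × Fin 3 →₀ ℕ := ∑ i ∈ A, Finsupp.single (i, k i) 1
  obtain ⟨m₀, hm₀⟩ : ∃ m₀, m = m₀ + u e := le_iff_exists_add'.1
    (sum_single_le fun i hi => hem i (Finset.mem_filter.1 hi).2)
  refine ⟨∑ k ∈ Finset.univ.erase e, c k • monomial (m₀ + u k) 1,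
    Submodule.sum_mem _ fun k hk => ?_, ?_⟩
  · by_cases hck : c k = 0
    · simp [hck]
    · refine Submodule.smul_mem _ _ ((monomial_mem_restrictSupport K).2 (.inl ?_))
      rw [Set.mem_ofPred_eq, hm₀, map_add, map_add]
      exact Nat.add_lt_add_left
        (indexWeight_sum_single_lt (hc k hck) (Finset.ne_of_mem_erase hk) hA) _
  · have hsum : monomial m 1 + ∑ k ∈ Finset.univ.erase e, c k • monomial (m₀ + u k) 1 =
        ∑ k, c k • (monomial (m₀ + u k) 1 : MvPolynomial (ι × Fin 3) K) := by
      rw [← Finset.add_sum_erase _ _ (Finset.mem_univ e), hce, one_smul, hm₀]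
    convert S.relations.mul_mem_right
      ((∏ i ∈ A, S.form i (L (i, 0))) * S.substForms L (monomial m₀ 1)) hrel using 1
    rw [hsum, map_sum, Finset.mul_sum, Finset.sum_mul]
    refine Finset.sum_congr rfl fun k _ => ?_
    by_cases hck : c k = 0
    · simp [hck]
    · have hkA : ∀ i ∉ A, k i = 0 := fun i hi => Fin.le_zero_iff.1 ((hc k hck i).trans_eq (hA i hi))
      rw [map_smul, mul_smul_comm, smul_mul_assoc, prod_mul_substForms_monomial hkA]

lemma exists_isStandard_and_prod_mul_mem (hex : S.Exact Finset.univ) (hL : InGeneralPosition K L)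
    (hLf : ∀ x, L x ⬝ᵥ S.focus x.1 = 0) (p : MvPolynomial (ι × Fin 3) K) :
    ∃ g : MvPolynomial (ι × Fin 3) K, (∀ m ∈ g.support, IsStandardOver 0 m) ∧
      (∏ i, S.form i (L (i, 0))) * S.substForms L (p - g) ∈ S.relations := by
  let reducible : Submodule K (MvPolynomial (ι × Fin 3) K) :=
    restrictSupport K {m | IsStandardOver 0 m} ⊔ (S.relations.restrictScalars K).comap
      (LinearMap.mulLeft K (∏ i, S.form i (L (i, 0))) ∘ₗ (S.substForms L).toLinearMap)
  have restrict_le {s : Set (ι × Fin 3 →₀ ℕ)} (hs : ∀ m ∈ s, monomial m 1 ∈ reducible) :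
      restrictSupport K s ≤ reducible := by
    rw [restrictSupport_eq_span, Submodule.span_le]
    exact Set.image_subset_iff.2 hs
  have monomial_mem (m : ι × Fin 3 →₀ ℕ) : monomial m 1 ∈ reducible := by
    induction hN : indexWeight m using Nat.strong_induction_on generalizing m with
    | _ N ih =>
    subst hN
    by_cases hm : IsStandardOver 0 m
    · exact Submodule.mem_sup_left ((monomial_mem_restrictSupport K).2 (.inl hm))
    · obtain ⟨g, hg, hmg⟩ := exists_prod_mul_substForms_mem hex hL hLf hm
      rw [← add_sub_cancel_right (monomial m 1) g]
      exact reducible.sub_mem (Submodule.mem_sup_right hmg)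
        (restrict_le (fun m' hm' => ih _ hm' m' rfl) hg)
  have hp : p ∈ reducible := restrict_le (s := Set.univ) (fun m _ => monomial_mem m)
    (by rw [restrictSupport_univ]; exact Submodule.mem_top)
  obtain ⟨g, hg, q, hq, rfl⟩ := Submodule.mem_sup.1 hp
  exact ⟨g, fun m hm => hg hm, by simpa using hq⟩

end TwoViewSystem

lemma IsStandardOver.sum_single_zero_add {ι : Type*} [Fintype ι] {m : ι × Fin 3 →₀ ℕ}
    (hm : IsStandardOver 0 m) : IsStandardOver 0 (∑ i, Finsupp.single (i, 0) 1 + m) := by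
  obtain ⟨e, he0, he, hme⟩ := hm
  refine ⟨e, he0, he, fun x hx => ⟨Nat.zero_le _, ?_⟩⟩
  rcases eq_or_ne x.2 0 with h0 | h0
  · simp [h0]
  · refine (hme x fun hmx => hx ?_).2
    rw [Finsupp.add_apply, hmx, add_zero, Finsupp.finsetSum_apply]
    exact Finset.sum_eq_zero fun i _ => Finsupp.single_eq_of_ne fun h => h0 (by rw [h])

namespace TwoViewSystem

variable {ι K R : Type*} [Field K] [CommRing R] [Algebra K R]
  {S : TwoViewSystem ι K R} {L : ι × Fin 3 → Fin 4 → K}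

lemma span_range_eq_of_inGeneralPosition (hL : InGeneralPosition K L)
    (hLf : ∀ x, L x ⬝ᵥ S.focus x.1 = 0) (i : ι) :
    Submodule.span K (Set.range fun k => L (i, k)) =
      LinearMap.ker (dotProductEquiv K _ (S.focus i)) := by
  have hind : LinearIndependent K fun k => L (i, k) := by
    have hunivind := (hL.comp (Prod.mk_right_injective i)) Finset.univ (by simp)
    rw [Finset.coe_univ, linearIndepOn_univ_iff] at hunivind
    exact hunivind
  refine Submodule.eq_of_le_of_finrank_eq (Submodule.span_le.2 ?_) ?_
  · rintro _ ⟨k, rfl⟩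
    simpa [dotProduct_comm] using hLf (i, k)
  · rw [finrank_span_eq_card hind, Fintype.card_fin,
      finrank_ker_dotProductEquiv (S.focus_ne_zero i)]

lemma exists_eq_sum_smul_of_inGeneralPosition (hL : InGeneralPosition K L)
    (hLf : ∀ x, L x ⬝ᵥ S.focus x.1 = 0) {i : ι} {w : Fin 4 → K} (hw : w ⬝ᵥ S.focus i = 0) :
    ∃ c : Fin 3 → K, w = ∑ k, c k • L (i, k) := by
  have hmem : w ∈ LinearMap.ker (dotProductEquiv K _ (S.focus i)) := by
    simpa [dotProduct_comm] using hw
  rw [← span_range_eq_of_inGeneralPosition hL hLf] at hmem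
  obtain ⟨c, hc⟩ := Submodule.mem_span_range_iff_exists_fun K |>.1 hmem
  exact ⟨c, hc.symm⟩

lemma substForms_surjective (hL : InGeneralPosition K L) (hLf : ∀ x, L x ⬝ᵥ S.focus x.1 = 0)
    (hgen : Algebra.adjoin K {x | ∃ i w, w ⬝ᵥ S.focus i = 0 ∧ x = S.form i w} = ⊤) :
    Function.Surjective (S.substForms L) := by
  rw [← AlgHom.range_eq_top, eq_top_iff, ← hgen, Algebra.adjoin_le_iff]
  rintro _ ⟨i, w, hw, rfl⟩
  obtain ⟨c, rfl⟩ := exists_eq_sum_smul_of_inGeneralPosition hL hLf hw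
  rw [map_sum]
  refine sum_mem fun k _ => ?_
  rw [map_smul]
  have hform : S.form i (L (i, k)) ∈ (S.substForms L).range := ⟨X (i, k), aeval_X _ _⟩
  exact Subalgebra.smul_mem _ hform _

variable [Fintype ι] {ev : (ι → K) → (Fin 4 → K) → R →ₐ[K] K}

lemma prod_zero_mul_mem [Infinite K] (hex : S.Exact Finset.univ) (hL : InGeneralPosition K L)
    (hLf : ∀ x, L x ⬝ᵥ S.focus x.1 = 0) (hsurj : Function.Surjective (S.substForms L))
    (hev : ∀ t q i w, w ⬝ᵥ S.focus i = 0 → ev t q (S.form i w) = t i * (w ⬝ᵥ q))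
    (hrel : ∀ t q, ∀ x ∈ S.relations, ev t q x = 0) {F : R} (hF : ∀ t q, ev t q F = 0) :
    (∏ i, S.form i (L (i, 0))) * F ∈ S.relations := by
  classical
  obtain ⟨p, rfl⟩ := hsurj F
  obtain ⟨g, hg, hpg⟩ := exists_isStandard_and_prod_mul_mem hex hL hLf p
  let z : MvPolynomial (ι × Fin 3) K := monomial (∑ i, Finsupp.single (i, 0) 1) 1
  have hz : S.substForms L z = ∏ i, S.form i (L (i, 0)) :=
    substForms_monomial_sum_single _ fun _ => 0
  have hzg : z * g = 0 := by
    refine eq_zero_of_isStandard (fun T hT x hx => hL.exists_mem_range (Nat.lt_succ_of_le hT) hx)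
      (fun m hm => ?_) ?_
    · obtain ⟨a, ha, b, hb, rfl⟩ := Finset.mem_add.1 (support_mul _ _ hm)
      rw [Finset.mem_singleton.1 (support_monomial_subset ha)]
      exact (hg b hb).sum_single_zero_add
    · rintro _ ⟨q, rfl⟩ t
      have hcomp : (ev t q).comp (S.substForms L) = aeval fun x => t x.1 * (L x ⬝ᵥ q) :=
        algHom_ext fun x => by simp [substForms, hev _ _ _ _ (hLf x)]
      have hzero := hrel t q _ hpg
      rw [map_sub, mul_sub, map_sub, map_mul _ _ (S.substForms L p), hF, mul_zero, zero_sub,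
        neg_eq_zero, ← hz, ← map_mul, ← AlgHom.comp_apply, hcomp] at hzero
      exact hzero
  have hzg' : (∏ i, S.form i (L (i, 0))) * S.substForms L g = 0 := by
    rw [← hz, ← map_mul, hzg, map_zero]
  rwa [map_sub, mul_sub, hzg', sub_zero] at hpg

theorem prod_mul_mem [Infinite K] (hex : S.Exact Finset.univ)
    (hgen : Algebra.adjoin K {x | ∃ i w, w ⬝ᵥ S.focus i = 0 ∧ x = S.form i w} = ⊤)
    (hev : ∀ t q i w, w ⬝ᵥ S.focus i = 0 → ev t q (S.form i w) = t i * (w ⬝ᵥ q))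
    (hrel : ∀ t q, ∀ x ∈ S.relations, ev t q x = 0) {F : R} (hF : ∀ t q, ev t q F = 0)
    {w : ι → Fin 4 → K} (hw : ∀ i, w i ⬝ᵥ S.focus i = 0) :
    (∏ i, S.form i (w i)) * F ∈ S.relations := by
  obtain ⟨L, hLf, hL⟩ := exists_inGeneralPosition S.focus_ne_zero S.focus_notMem_span
  have prod_mem (k : ι → Fin 3) : (∏ i, S.form i (L (i, k i))) * F ∈ S.relations := by
    let e (x : ι × Fin 3) : ι × Fin 3 := (x.1, Equiv.swap 0 (k x.1) x.2)
    have he : Function.Injective e := by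
      rintro ⟨i, l⟩ ⟨i', l'⟩ h
      obtain ⟨rfl, hl⟩ := Prod.mk.inj h
      have hl' : l = l' := (Equiv.injective _) hl
      rw [hl']
    have hLe : ∀ x, (L ∘ e) x ⬝ᵥ S.focus x.1 = 0 := fun x => hLf (e x)
    simpa [e] using prod_zero_mul_mem hex (hL.comp he) hLe
      (substForms_surjective (hL.comp he) hLe hgen) hev hrel hF
  classical
  choose c hc using fun i => exists_eq_sum_smul_of_inGeneralPosition hL hLf (hw i)
  have hexpand : (∏ i, S.form i (w i)) * F =
      ∑ k : ι → Fin 3, (∏ i, c i (k i)) • ((∏ i, S.form i (L (i, k i))) * F) := by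
    rw [Finset.prod_congr rfl fun i _ => by rw [hc i, map_sum], Finset.prod_univ_sum,
      Fintype.piFinset_univ, Finset.sum_mul]
    refine Finset.sum_congr rfl fun k _ => ?_
    simp only [map_smul, Finset.prod_smul, smul_mul_assoc]
  rw [hexpand]
  exact S.relations.sum_mem fun k _ => Submodule.smul_of_tower_mem _ _ (prod_mem k)

end TwoViewSystem

namespace Camera

variable (A : Camera)

/-- A vector of homogeneous coordinates of the focus. -/
def focusVector : Fin 4 → ℝ := A.focus.rep

lemma focusVector_ne_zero : A.focusVector ≠ 0 := A.focus.rep_nonzero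

lemma mk_focusVector : Projectivization.mk ℝ A.focusVector A.focusVector_ne_zero = A.focus :=
  A.focus.mk_rep

lemma mulVec_eq_zero_iff {q : Fin 4 → ℝ} :
    A.mat *ᵥ q = 0 ↔ q ∈ Submodule.span ℝ {A.focusVector} := by
  rw [focusVector, ← Projectivization.submodule_eq, focus, Projectivization.submodule_mk'',
    LinearMap.mem_ker, mulVecLin_apply]

/-- The camera matrix over `ℂ`. -/
def complexMat : Matrix (Fin 3) (Fin 4) ℂ := A.mat.map Complex.ofRealHom

/-- The vector of homogeneous coordinates of the focus over `ℂ`. -/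
def complexFocus : Fin 4 → ℂ := Complex.ofRealHom ∘ A.focusVector

lemma complexMat_mulVec_ofReal (q : Fin 4 → ℝ) :
    A.complexMat *ᵥ (Complex.ofRealHom ∘ q) = Complex.ofRealHom ∘ (A.mat *ᵥ q) :=
  funext fun k => (RingHom.map_mulVec _ _ _ k).symm

lemma complexMat_mulVec_ofReal_eq_image (q : Fin 4 → ℝ) :
    A.complexMat *ᵥ (Complex.ofRealHom ∘ q) = A.image q :=
  A.complexMat_mulVec_ofReal q

lemma complexMat_mulVec_complexFocus : A.complexMat *ᵥ A.complexFocus = 0 := by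
  rw [complexFocus, complexMat_mulVec_ofReal,
    A.mulVec_eq_zero_iff.2 (Submodule.mem_span_singleton_self _)]
  exact funext fun _ => map_zero _

lemma complexMat_dotProduct_complexFocus (k : Fin 3) : A.complexMat k ⬝ᵥ A.complexFocus = 0 :=
  congrFun A.complexMat_mulVec_complexFocus k

lemma complexFocus_ne_zero : A.complexFocus ≠ 0 := by
  obtain ⟨k, hk⟩ := Function.ne_iff.1 A.focusVector_ne_zero
  exact Function.ne_iff.2 ⟨k, Complex.ofReal_ne_zero.2 hk⟩

lemma exists_mul_eq_one : ∃ B : Matrix (Fin 4) (Fin 3) ℝ, A.mat * B = 1 := by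
  have hrange : LinearMap.range A.mat.mulVecLin = ⊤ :=
    Submodule.eq_top_of_finrank_eq (by rw [Module.finrank_fin_fun]; exact A.rank_mat)
  exact mulVec_surjective_iff_exists_right_inverse.1 (LinearMap.range_eq_top.1 hrange)

/-- A right inverse of the camera matrix. It expresses the linear forms vanishing at the focus in
the rows of the camera matrix. -/
def rightInverse : Matrix (Fin 4) (Fin 3) ℂ := A.exists_mul_eq_one.choose.map Complex.ofRealHom

lemma complexMat_mul_rightInverse : A.complexMat * A.rightInverse = 1 := by
  rw [complexMat, rightInverse, ← Matrix.map_mul, A.exists_mul_eq_one.choose_spec,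
    Matrix.map_one _ (map_zero _) (map_one _)]

lemma exists_rightInverse_mul_complexMat :
    ∃ d, A.rightInverse * A.complexMat = 1 - vecMulVec A.complexFocus d := by
  obtain ⟨B, hB, hAB⟩ : ∃ B : Matrix (Fin 4) (Fin 3) ℝ,
      A.rightInverse = B.map Complex.ofRealHom ∧ A.mat * B = 1 :=
    ⟨_, rfl, A.exists_mul_eq_one.choose_spec⟩
  have hcol (j : Fin 4) : ∃ c : ℝ, c • A.focusVector = (1 - B * A.mat).col j := by
    have hzero : A.mat * (1 - B * A.mat) = 0 := by
      rw [Matrix.mul_sub, ← Matrix.mul_assoc, hAB, Matrix.one_mul, Matrix.mul_one, sub_self]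
    rw [← Submodule.mem_span_singleton, ← mulVec_eq_zero_iff]
    exact funext fun k => congrFun (congrFun hzero k) j
  choose d hd using hcol
  refine ⟨Complex.ofRealHom ∘ d, ?_⟩
  have hBA : B * A.mat = 1 - vecMulVec A.focusVector d := by
    ext i j
    have hij := congrFun (hd j) i
    simp only [Pi.smul_apply, smul_eq_mul, col_apply, Matrix.sub_apply] at hij
    rw [Matrix.sub_apply, vecMulVec_apply, mul_comm, hij, sub_sub_cancel]
  rw [hB, complexMat, ← Matrix.map_mul, hBA, Matrix.map_sub _ (map_sub _),
    Matrix.map_one _ (map_zero _) (map_one _)]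
  exact congrArg (1 - ·) (Matrix.ext fun i j =>
    map_mul Complex.ofRealHom (A.focusVector i) (d j))

lemma vecMul_rightInverse_vecMul_complexMat {w : Fin 4 → ℂ} (hw : w ⬝ᵥ A.complexFocus = 0) :
    (w ᵥ* A.rightInverse) ᵥ* A.complexMat = w := by
  obtain ⟨d, hd⟩ := A.exists_rightInverse_mul_complexMat
  rw [vecMul_vecMul, hd, vecMul_sub, vecMul_one, vecMul_vecMulVec, hw, zero_smul, sub_zero]

lemma complexMat_vecMul_rightInverse (k : Fin 3) :
    A.complexMat k ᵥ* A.rightInverse = Pi.single k 1 := by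
  rw [← mul_apply_eq_vecMul, complexMat_mul_rightInverse]
  exact funext fun _ => one_eq_pi_single

lemma complexMat_mulVec_eq_zero_iff {q : Fin 4 → ℂ} :
    A.complexMat *ᵥ q = 0 ↔ q ∈ Submodule.span ℂ {A.complexFocus} := by
  refine ⟨fun hq => ?_, fun hq => ?_⟩
  · obtain ⟨d, hd⟩ := A.exists_rightInverse_mul_complexMat
    have hdq := congrArg (· *ᵥ q) hd
    simp only [← mulVec_mulVec, hq, mulVec_zero, sub_mulVec, one_mulVec, vecMulVec_mulVec,
      op_smul_eq_smul] at hdq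
    exact Submodule.mem_span_singleton.2 ⟨_, (sub_eq_zero.1 hdq.symm).symm⟩
  · obtain ⟨c, rfl⟩ := Submodule.mem_span_singleton.1 hq
    rw [mulVec_smul, complexMat_mulVec_complexFocus, smul_zero]

variable {A}

lemma complexFocus_notMem_span {A' : Camera} (h : A.focus ≠ A'.focus) :
    A.complexFocus ∉ Submodule.span ℂ {A'.complexFocus} := by
  intro hmem
  rw [← complexMat_mulVec_eq_zero_iff, complexFocus, complexMat_mulVec_ofReal] at hmem
  have hreal : A'.mat *ᵥ A.focusVector = 0 :=
    funext fun k => Complex.ofReal_eq_zero.1 (congrFun hmem k)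
  obtain ⟨c, hc⟩ := Submodule.mem_span_singleton.1 (A'.mulVec_eq_zero_iff.1 hreal)
  refine h ?_
  rw [← A.mk_focusVector, ← A'.mk_focusVector, Projectivization.mk_eq_mk_iff']
  exact ⟨c, hc⟩

end Camera

section Minors

variable {R α β : Type*} [CommRing R]

lemma minors_le_ker_of_mulVec_eq_zero {D : Type*} [CommRing D] [IsDomain D] [Fintype β]
    (ψ : R →+* D) {k : ℕ} (hk : Fintype.card β = k) {M : Matrix α β R} {v : β → D} (hv : v ≠ 0)
    (h : M.map ψ *ᵥ v = 0) : minors k M ≤ RingHom.ker ψ := by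
  refine Ideal.span_le.2 ?_
  rintro - ⟨r, c, rfl⟩
  let e : Fin k ≃ β := Equiv.ofBijective c
    ((Fintype.bijective_iff_injective_and_card _).2 ⟨c.injective, by rw [Fintype.card_fin, hk]⟩)
  have hve : v ∘ e ≠ 0 := fun h0 => hv (funext fun b => by simpa using congrFun h0 (e.symm b))
  rw [SetLike.mem_coe, RingHom.mem_ker, RingHom.map_det, ← exists_mulVec_eq_zero_iff]
  refine ⟨v ∘ e, hve, funext fun i => ?_⟩
  have hi := congrFun h (r i)
  rwa [mulVec, dotProduct, ← e.sum_comp] at hi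

lemma submatrix_det_mem_minors [Fintype β] [DecidableEq β] {k : ℕ} (hk : Fintype.card β = k)
    (M : Matrix α β R) (κ : β ↪ α) : (M.submatrix κ id).det ∈ minors k M := by
  let e : Fin k ≃ β := (Fintype.equivFinOfCardEq hk).symm
  rw [← det_submatrix_equiv_self e]
  exact Ideal.subset_span ⟨e.toEmbedding.trans κ, e.toEmbedding, rfl⟩

lemma det_mul_mem_minors [Fintype α] [Fintype β] [DecidableEq β] {k : ℕ}
    (hk : Fintype.card β = k) (e : α ≃ β) (C : Matrix β α R) (M : Matrix α β R) :
    (C * M).det ∈ minors k M := by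
  classical
  have hdet : (C * M).det =
      (C.submatrix id e.symm).det * (M.submatrix e.symm.toEmbedding id).det := by
    rw [← det_mul]
    exact congrArg det (submatrix_mul_equiv C M id e.symm id).symm
  exact hdet ▸ Ideal.mul_mem_left _ _ (submatrix_det_mem_minors hk M _)

lemma exists_det_submatrix_ne_zero {K : Type*} [Field K] [Fintype β] [DecidableEq β]
    {M : Matrix α β K} (h : ∀ v, M *ᵥ v = 0 → v = 0) :
    ∃ κ : β ↪ α, (M.submatrix κ id).det ≠ 0 := by
  have hspan : Submodule.span K (Set.range M) = ⊤ := by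
    refine (Submodule.eq_top_iff').2 fun x => ?_
    by_contra hx
    obtain ⟨w, hw, hwx⟩ := exists_dotProduct_eq_zero_and_ne_zero hx
    refine hwx ?_
    rw [h w (funext fun a => ?_), zero_dotProduct]
    exact (dotProduct_comm _ _).trans (hw _ (Submodule.subset_span ⟨a, rfl⟩))
  obtain ⟨κ, a, ha, hκspan, hκ⟩ := exists_linearIndependent' K M
  let b := Module.Basis.mk hκ (by rw [hκspan, hspan])
  let e : β ≃ κ := (Pi.basisFun K β).indexEquiv b
  refine ⟨e.toEmbedding.trans ⟨a, ha⟩, IsUnit.ne_zero ?_⟩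
  rw [← isUnit_iff_isUnit_det, ← linearIndependent_rows_iff_isUnit]
  exact hκ.comp e e.injective

lemma exists_mem_minors_map_ne_zero {K : Type*} [Field K] [Fintype β] (ψ : R →+* K) {k : ℕ}
    (hk : Fintype.card β = k) {M : Matrix α β R} (h : ∀ v, M.map ψ *ᵥ v = 0 → v = 0) :
    ∃ g ∈ minors k M, ψ g ≠ 0 := by
  classical
  obtain ⟨κ, hκ⟩ := exists_det_submatrix_ne_zero h
  exact ⟨_, submatrix_det_mem_minors hk M κ, by rwa [RingHom.map_det]⟩

end Minors

section JointImage

variable {n : ℕ} (A : Fin n → Camera)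

/-- The linear form on the image plane of camera `i` whose pullback to 3-space is the given form,
written in the variables `pᵢ`; forms not vanishing at the focus are first projected along the
chosen right inverse. -/
def imageForm (i : Fin n) : (Fin 4 → ℂ) →ₗ[ℂ] PolyRing n :=
  (rename (Prod.mk i)).toLinearMap ∘ₗ linearForm ∘ₗ (A i).rightInverse.vecMulLinear

lemma imageForm_row (i : Fin n) (k : Fin 3) : imageForm A i ((A i).complexMat k) = X (i, k) := by
  simp only [imageForm, LinearMap.comp_apply, vecMulLinear_apply,
    Camera.complexMat_vecMul_rightInverse, linearForm_single, AlgHom.toLinearMap_apply, rename_X]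

/-- Substitution of the images `tᵢ Aᵢ q` of a generic point `q` of 3-space, with generic scalars
`tᵢ`, for the variables `pᵢ`. The variable `inl i` is `tᵢ`, the variables `inr j` are the
coordinates of `q`. -/
def genericJointImage : PolyRing n →ₐ[ℂ] MvPolynomial (Fin n ⊕ Fin 4) ℂ :=
  aeval fun x => X (.inl x.1) * rename .inr (linearForm ((A x.1).complexMat x.2))

lemma genericJointImage_X (i : Fin n) (k : Fin 3) : genericJointImage A (X (i, k)) =
    X (.inl i) * rename .inr (linearForm ((A i).complexMat k)) :=
  aeval_X _ _

lemma genericJointImage_imageForm (i : Fin n) {w : Fin 4 → ℂ} (hw : w ⬝ᵥ (A i).complexFocus = 0) :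
    genericJointImage A (imageForm A i w) = X (.inl i) * rename .inr (linearForm w) := by
  have hlin (u : Fin 3 → ℂ) : linearForm (u ᵥ* (A i).complexMat) =
      ∑ k, u k • linearForm ((A i).complexMat k) := by
    rw [vecMul_eq_sum, map_sum]
    exact Finset.sum_congr rfl fun k _ => map_smul _ _ _
  conv_rhs => rw [← (A i).vecMul_rightInverse_vecMul_complexMat hw, hlin]
  simp only [imageForm, LinearMap.comp_apply, vecMulLinear_apply, linearForm_apply,
    AlgHom.toLinearMap_apply, map_sum, map_mul, rename_X, algHom_C, algebraMap_eq,
    genericJointImage_X, Finset.mul_sum, smul_eq_C_mul]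
  exact Finset.sum_congr rfl fun k _ => Finset.sum_congr rfl fun j _ => by ring

lemma genericJointImage_X_ne_zero (x : Fin n × Fin 3) : genericJointImage A (X x) ≠ 0 := by
  obtain ⟨i, k⟩ := x
  rw [genericJointImage_X]
  refine mul_ne_zero (X_ne_zero _) fun h => one_ne_zero (α := ℂ) ?_
  have hzero : linearForm ((A i).complexMat k) = 0 :=
    rename_injective _ Sum.inr_injective (h.trans (map_zero _).symm)
  have hrow := congrArg (eval ((A i).rightInverse.col k)) hzero
  rw [eval_linearForm, map_zero] at hrow
  exact (one_apply_eq k).symm.trans <|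
    (congrFun (congrFun (A i).complexMat_mul_rightInverse k) k).symm.trans hrow

lemma eval_genericJointImage (t : Fin n → ℂ) (q : Fin 4 → ℂ) (F : PolyRing n) :
    eval (Sum.elim t q) (genericJointImage A F) =
      eval (fun x => (t x.1 • (A x.1).complexMat *ᵥ q) x.2) F := by
  simp only [← coe_aeval_eq_eval, RingHom.coe_coe]
  rw [genericJointImage, ← AlgHom.comp_apply, comp_aeval]
  congr 2
  funext x
  rw [map_mul, aeval_X, aeval_rename, Sum.elim_inl, Sum.elim_comp_inr]
  exact congrArg _ (eval_linearForm _ _)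

lemma mem_multiviewIdeal_of_genericJointImage_eq_zero {F : PolyRing n}
    (hF : genericJointImage A F = 0) : F ∈ multiviewIdeal A := by
  rintro P ⟨q, -, hP⟩ u hu
  have hscale (i) : ∃ t : ℂ, t • (A i).image q = u i := by
    obtain ⟨hu0, hmk⟩ := hu i
    obtain ⟨hq0, hPq⟩ := hP i
    exact (Projectivization.mk_eq_mk_iff' ℂ _ _ hu0 hq0).1 (hmk.trans hPq)
  choose t ht using hscale
  have heval := eval_genericJointImage A t (Complex.ofRealHom ∘ q) F
  simp only [hF, map_zero, Camera.complexMat_mulVec_ofReal_eq_image, ht] at heval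
  exact heval.symm

lemma eval_genericJointImage_eq_zero_of_mem_multiviewIdeal {F : PolyRing n}
    (hF : F ∈ multiviewIdeal A) {t : Fin n → ℂ} (ht : ∀ i, t i ≠ 0) {q : Fin 4 → ℝ} (hq : q ≠ 0)
    (himage : ∀ i, (A i).image q ≠ 0) :
    eval (Sum.elim t (Complex.ofRealHom ∘ q)) (genericJointImage A F) = 0 := by
  simp only [eval_genericJointImage, Camera.complexMat_mulVec_ofReal_eq_image]
  exact hF (fun i => Projectivization.mk ℂ _ (himage i)) ⟨q, hq, fun i => ⟨himage i, rfl⟩⟩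
    (fun i => t i • (A i).image q) fun i => ⟨smul_ne_zero (ht i) (himage i),
      (Projectivization.mk_eq_mk_iff' ℂ _ _ _ _).2 ⟨t i, rfl⟩⟩

lemma genericJointImage_eq_zero_of_mem_multiviewIdeal {F : PolyRing n}
    (hF : F ∈ multiviewIdeal A) : genericJointImage A F = 0 := by
  let N : MvPolynomial (Fin n ⊕ Fin 4) ℂ := genericJointImage A (∏ i, X (i, 0)) * X (.inr 0)
  have hN : N ≠ 0 := by
    refine mul_ne_zero ?_ (X_ne_zero _)
    rw [map_prod]
    exact Finset.prod_ne_zero_iff.2 fun i _ => genericJointImage_X_ne_zero A _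
  refine (mul_eq_zero.1 (?_ : genericJointImage A F * N = 0)).resolve_right hN
  refine funext_set (fun _ => Set.range Complex.ofRealHom)
    (fun _ => Set.infinite_range_of_injective Complex.ofRealHom.injective) fun x hx => ?_
  choose y hy using fun v => hx v (Set.mem_univ v)
  obtain ⟨t, q, rfl⟩ : ∃ t q, Sum.elim t (Complex.ofRealHom ∘ q) = x :=
    ⟨x ∘ .inl, y ∘ .inr, funext fun v => by cases v <;> simp [← hy]⟩
  rw [map_zero, map_mul, mul_eq_zero, or_iff_not_imp_right]
  intro hNx
  simp only [N, map_mul, eval_genericJointImage, map_prod, eval_X, Pi.smul_apply,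
    Camera.complexMat_mulVec_ofReal_eq_image, Finset.prod_mul_distrib, smul_eq_mul, mul_ne_zero_iff,
    Finset.prod_ne_zero_iff, Finset.mem_univ, true_imp_iff] at hNx
  obtain ⟨⟨ht, himage⟩, hq⟩ := hNx
  refine eval_genericJointImage_eq_zero_of_mem_multiviewIdeal A hF ht ?_ fun i =>
    Function.ne_iff.2 ⟨0, himage i⟩
  rintro rfl
  simp at hq

theorem multiviewIdeal_eq_ker : multiviewIdeal A = RingHom.ker (genericJointImage A) :=
  le_antisymm (fun _ => genericJointImage_eq_zero_of_mem_multiviewIdeal A)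
    fun _ => mem_multiviewIdeal_of_genericJointImage_eq_zero A

end JointImage

section IrrelevantIdeal

variable {n : ℕ}

lemma prod_X_mem_irrelevantIdeal (k : Fin n → Fin 3) : ∏ i, X (i, k i) ∈ irrelevantIdeal n := by
  refine Submodule.mem_iInf _ |>.2 fun i => ?_
  rw [← Finset.mul_prod_erase _ _ (Finset.mem_univ i)]
  exact Ideal.mul_mem_right _ _ (Ideal.subset_span ⟨k i, rfl⟩)

theorem irrelevantIdeal_eq_span :
    irrelevantIdeal n = Ideal.span (Set.range fun k : Fin n → Fin 3 => ∏ i, X (i, k i)) := by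
  refine le_antisymm (fun g hg => ?_)
    (Ideal.span_le.2 (Set.range_subset_iff.2 prod_X_mem_irrelevantIdeal))
  have hsupport (m) (hm : m ∈ g.support) (i : Fin n) : ∃ k : Fin 3, m (i, k) ≠ 0 := by
    have hgi : g ∈ Ideal.span (X '' Set.range fun k : Fin 3 => (i, k)) := by
      rw [← Set.range_comp]
      exact (Submodule.mem_iInf _).1 hg i
    obtain ⟨-, ⟨k, rfl⟩, hk⟩ := mem_ideal_span_X_image.1 hgi m hm
    exact ⟨k, hk⟩
  rw [g.as_sum]
  refine sum_mem fun m hm => ?_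
  choose k hk using hsupport m hm
  have hle : ∑ i, Finsupp.single (i, k i) 1 ≤ m := sum_single_le fun i _ => hk i
  have hprod : monomial (∑ i, Finsupp.single (i, k i) 1) (1 : ℂ) = ∏ i, X (i, k i) :=
    monomial_sum_one _ _
  rw [← tsub_add_cancel_of_le hle, ← mul_one (coeff _ g), ← monomial_mul, hprod]
  exact Ideal.mul_mem_left _ _ (Ideal.subset_span ⟨k, rfl⟩)

lemma mem_colon_irrelevantIdeal {I : Ideal (PolyRing n)} {F : PolyRing n} :
    F ∈ I.colon (irrelevantIdeal n : Set (PolyRing n)) ↔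
      ∀ k : Fin n → Fin 3, F * ∏ i, X (i, k i) ∈ I := by
  rw [irrelevantIdeal_eq_span, Ideal.colon_span, Submodule.mem_colon, Set.forall_mem_range]
  rfl

end IrrelevantIdeal

section FocalIdeal

variable {n : ℕ} (A : Fin n → Camera)

lemma symbolicMatrix_map_mulVec_eq_zero_iff {D : Type*} [CommRing D] (ψ : PolyRing n →+* D)
    {σ : Finset (Fin n)} {v : Fin 4 ⊕ σ → D} :
    (symbolicMatrix A σ).map ψ *ᵥ v = 0 ↔ ∀ i : σ,
      (A i).complexMat.map (ψ.comp C) *ᵥ (v ∘ .inl) +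
        v (.inr i) • (fun k => ψ (X (↑i, k))) = 0 := by
  have hrow (i : σ) (k : Fin 3) : ((symbolicMatrix A σ).map ψ *ᵥ v) (i, k) =
      ((A i).complexMat.map (ψ.comp C) *ᵥ (v ∘ .inl)) k + v (.inr i) * ψ (X (↑i, k)) := by
    simp only [mulVec, dotProduct, Fintype.sum_sum_type]
    congr 1
    simp [symbolicMatrix, apply_ite ψ, mul_comm]
  simp only [funext_iff, Prod.forall, hrow]
  rfl

variable {A}

lemma card_sum_coe_eq {k : ℕ} {σ : Finset (Fin n)} (hσ : σ.card = k) :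
    Fintype.card (Fin 4 ⊕ σ) = 4 + k := by
  simp [hσ]

lemma focalIdeal_le_iff {k : ℕ} {I : Ideal (PolyRing n)} :
    focalIdeal A k ≤ I ↔
      ∀ σ : Finset (Fin n), σ.card = k → minors (4 + k) (symbolicMatrix A σ) ≤ I := by
  simp [focalIdeal, Finset.mem_powersetCard]

lemma minors_le_focalIdeal {k : ℕ} {σ : Finset (Fin n)} (hσ : σ.card = k) :
    minors (4 + k) (symbolicMatrix A σ) ≤ focalIdeal A k :=
  focalIdeal_le_iff.1 le_rfl σ hσ

lemma focalIdeal_le_ker_of_forall_exists {D : Type*} [CommRing D] [IsDomain D]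
    (ψ : PolyRing n →+* D) {k : ℕ}
    (h : ∀ σ : Finset (Fin n), σ.card = k → ∃ (q : Fin 4 → D) (τ : Fin n → D),
      (q ≠ 0 ∨ ∃ i ∈ σ, τ i ≠ 0) ∧ ∀ i ∈ σ,
        (A i).complexMat.map (ψ.comp C) *ᵥ q + τ i • (fun l => ψ (X (i, l))) = 0) :
    focalIdeal A k ≤ RingHom.ker ψ := by
  refine focalIdeal_le_iff.2 fun σ hσ => ?_
  obtain ⟨q, τ, hne, hq⟩ := h σ hσ
  refine minors_le_ker_of_mulVec_eq_zero ψ (card_sum_coe_eq hσ)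
    (v := Sum.elim q fun i => τ i) (fun h0 => ?_)
    ((symbolicMatrix_map_mulVec_eq_zero_iff A ψ).2 fun i => hq i i.2)
  rcases hne with hq0 | ⟨i, hi, hτ⟩
  · exact hq0 (funext fun j => congrFun h0 (.inl j))
  · exact hτ (congrFun h0 (.inr ⟨i, hi⟩))

lemma map_C_mulVec_X_comp_inr {K ι α β : Type*} [Field K] [Fintype β] (M : Matrix α β K) :
    M.map C *ᵥ (X ∘ Sum.inr : β → MvPolynomial (ι ⊕ β) K) =
      fun l => rename Sum.inr (linearForm (M l)) := by
  funext l
  simp only [mulVec, dotProduct, linearForm_apply, map_sum, map_mul, rename_X, rename_C, map_apply,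
    Function.comp_apply]

variable (A) in
lemma focalIdeal_le_ker_genericJointImage (k : ℕ) :
    focalIdeal A k ≤ RingHom.ker (genericJointImage A) := by
  refine focalIdeal_le_ker_of_forall_exists
    (genericJointImage A : PolyRing n →+* MvPolynomial (Fin n ⊕ Fin 4) ℂ) fun σ _ => ?_
  have hC := (genericJointImage A).comp_algebraMap
  let P (s : Finset (Fin n)) : MvPolynomial (Fin n ⊕ Fin 4) ℂ := ∏ i ∈ s, X (Sum.inl i)
  have hP : P σ ≠ 0 := Finset.prod_ne_zero_iff.2 fun i _ => X_ne_zero _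
  refine ⟨P σ • (X ∘ Sum.inr), fun i => -P (σ.erase i),
    .inl (smul_ne_zero hP fun h0 => X_ne_zero (R := ℂ) (Sum.inr 0) (congrFun h0 0)),
    fun i hi => funext fun l => ?_⟩
  have hPi : P σ = X (Sum.inl i) * P (σ.erase i) := (Finset.mul_prod_erase σ _ hi).symm
  rw [← algebraMap_eq, hC, algebraMap_eq, mulVec_smul, map_C_mulVec_X_comp_inr, hPi]
  simp only [Pi.add_apply, Pi.smul_apply, smul_eq_mul, RingHom.coe_coe, genericJointImage_X,
    Pi.zero_apply]
  ring

theorem focalIdeal_le_multiviewIdeal (k : ℕ) : focalIdeal A k ≤ multiviewIdeal A :=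
  multiviewIdeal_eq_ker A ▸ focalIdeal_le_ker_genericJointImage A k

end FocalIdeal

lemma exists_equiv_pair {α : Type*} [DecidableEq α] {i j : α} (hij : i ≠ j) :
    ∃ e : Fin 2 ≃ ({i, j} : Finset α), (e 0 : α) = i ∧ (e 1 : α) = j := by
  let f : Fin 2 → ({i, j} : Finset α) := ![⟨i, by simp⟩, ⟨j, by simp⟩]
  have hf : f.Injective := by
    intro a b hab
    fin_cases a <;> fin_cases b <;> simp_all [f]
  exact ⟨Equiv.ofBijective f ((Fintype.bijective_iff_injective_and_card f).2
    ⟨hf, by simp [Finset.card_pair hij]⟩), rfl, rfl⟩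

lemma exists_add_eq_of_notMem_span {τ K : Type*} [Fintype τ] [Field K] {f g : τ → K}
    (h : f ∉ Submodule.span K {g}) (w : τ → K) :
    ∃ u v, u ⬝ᵥ f = 0 ∧ v ⬝ᵥ g = 0 ∧ u + v = w := by
  obtain ⟨v, hvg, hvf⟩ := exists_dotProduct_eq_zero_and_ne_zero h
  refine ⟨w - ((w ⬝ᵥ f) / (v ⬝ᵥ f)) • v, ((w ⬝ᵥ f) / (v ⬝ᵥ f)) • v, ?_, ?_, sub_add_cancel _ _⟩
  · rw [sub_dotProduct, smul_dotProduct, smul_eq_mul, div_mul_cancel₀ _ hvf, sub_self]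
  · rw [smul_dotProduct, hvg g (Submodule.mem_span_singleton_self _), smul_zero]

section Exchange

variable {n : ℕ} {A : Fin n → Camera}

lemma vecMul_symbolicMatrix {σ : Finset (Fin n)} {W : σ → Fin 4 → ℂ}
    (hW : ∀ i : σ, W i ⬝ᵥ (A i).complexFocus = 0) :
    (fun x => C ((W x.1 ᵥ* (A x.1).rightInverse) x.2)) ᵥ* symbolicMatrix A σ =
      Sum.elim (C ∘ ∑ i, W i) fun i : σ => imageForm A i (W i) := by
  have hrow (i : σ) (l : Fin 4) :
      ∑ k, (W i ᵥ* (A i).rightInverse) k * (A i).complexMat k l = W i l :=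
    congrFun ((A i).vecMul_rightInverse_vecMul_complexMat (hW i)) l
  funext c
  rcases c with l | i
  · simp only [Sum.elim_inl, Function.comp_apply, Finset.sum_apply, ← hrow, map_sum, map_mul]
    exact Fintype.sum_prod_type _
  · simp [vecMul, dotProduct, Fintype.sum_prod_type, symbolicMatrix, imageForm, linearForm_apply]

lemma det_imageForm_mem_focalIdeal_two {σ : Finset (Fin n)} (hσ : σ.card = 2)
    (hsum : ∀ w, ∃ U : σ → Fin 4 → ℂ, (∀ i, U i ⬝ᵥ (A i).complexFocus = 0) ∧ ∑ i, U i = w)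
    {V : σ → σ → Fin 4 → ℂ} (hV : ∀ s i, V s i ⬝ᵥ (A i).complexFocus = 0)
    (hV0 : ∀ s, ∑ i, V s i = 0) :
    (of fun s (i : σ) => imageForm A i (V s i)).det ∈ focalIdeal A 2 := by
  choose U hU hUsum using fun l : Fin 4 => hsum (Pi.single l 1)
  let T : Matrix (Fin 4 ⊕ σ) (σ × Fin 3) (PolyRing n) := of fun r x =>
    C ((Sum.elim U V r x.1 ᵥ* (A x.1).rightInverse) x.2)
  have hinl (l) : (T * symbolicMatrix A σ) (.inl l) =
      Sum.elim (Pi.single l 1) fun i : σ => imageForm A i (U l i) := by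
    rw [mul_apply_eq_vecMul]
    refine (vecMul_symbolicMatrix (hU l)).trans ?_
    rw [hUsum]
    exact congrArg (Sum.elim · _) (funext fun j => by simp [Pi.single_apply, apply_ite C])
  have hinr (s) : (T * symbolicMatrix A σ) (.inr s) =
      Sum.elim (0 : Fin 4 → PolyRing n) fun i : σ => imageForm A i (V s i) := by
    rw [mul_apply_eq_vecMul]
    refine (vecMul_symbolicMatrix (hV s)).trans ?_
    rw [hV0]
    exact congrArg (Sum.elim · _) (funext fun _ => map_zero C)
  have hblocks : T * symbolicMatrix A σ = fromBlocks 1 (of fun l (i : σ) => imageForm A i (U l i))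
      0 (of fun s (i : σ) => imageForm A i (V s i)) := by
    funext r c
    rcases r with l | s
    · rw [hinl]
      rcases c with j | i
      · exact one_eq_pi_single.symm
      · rfl
    · rw [hinr]
      rcases c with j | i <;> rfl
  refine minors_le_focalIdeal hσ ?_
  have e : σ × Fin 3 ≃ Fin 4 ⊕ σ := Fintype.equivOfCardEq (by simp [hσ])
  have hmem := det_mul_mem_minors (card_sum_coe_eq hσ) e T (symbolicMatrix A σ)
  rwa [hblocks, det_fromBlocks_zero₂₁, det_one, one_mul] at hmem

lemma imageForm_exchange_mem_focalIdeal_two {i j : Fin n} (hij : (A i).focus ≠ (A j).focus)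
    {w w' : Fin 4 → ℂ} (hwi : w ⬝ᵥ (A i).complexFocus = 0) (hwj : w ⬝ᵥ (A j).complexFocus = 0)
    (hwi' : w' ⬝ᵥ (A i).complexFocus = 0) (hwj' : w' ⬝ᵥ (A j).complexFocus = 0) :
    imageForm A i w * imageForm A j w' - imageForm A i w' * imageForm A j w ∈ focalIdeal A 2 := by
  have hne : i ≠ j := fun h => hij (h ▸ rfl)
  obtain ⟨e, he0, he1⟩ := exists_equiv_pair hne
  let V : Fin 2 → Fin 2 → Fin 4 → ℂ := ![![w, -w], ![-w', w']]
  have hmem := det_imageForm_mem_focalIdeal_two (Finset.card_pair hne) (A := A)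
    (V := fun s l => V (e.symm s) (e.symm l)) (fun w => ?_) ?_ ?_
  · rw [← det_submatrix_equiv_self e, det_fin_two] at hmem
    simp only [submatrix_apply, of_apply, Equiv.symm_apply_apply, he0, he1, V, cons_val_zero,
      cons_val_one, map_neg] at hmem
    convert hmem using 1
    ring
  · obtain ⟨u, v, hu, hv, rfl⟩ := exists_add_eq_of_notMem_span
      (Camera.complexFocus_notMem_span hij) w
    refine ⟨fun l => ![u, v] (e.symm l), e.forall_congr_right.1 fun a => ?_, ?_⟩
    · simp only [Equiv.symm_apply_apply]
      fin_cases a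
      · simpa [he0]
      · simpa [he1]
    · rw [← e.sum_comp, Fin.sum_univ_two]
      simp
  · refine fun s => e.forall_congr_right.1 fun a => ?_
    rw [Equiv.symm_apply_apply]
    generalize e.symm s = b
    fin_cases a <;> fin_cases b <;> simpa [V, he0, he1]
  · intro s
    rw [← e.sum_comp, Fin.sum_univ_two]
    generalize e.symm s = b
    fin_cases b <;> simp [V]

end Exchange

section Bifocal

variable {n : ℕ} {A : Fin n → Camera}

theorem isCoplanar_iff_exists_forall_dotProduct_complexFocus_eq_zero :
    IsCoplanar A ↔ ∃ w : Fin 4 → ℂ, w ≠ 0 ∧ ∀ i, w ⬝ᵥ (A i).complexFocus = 0 := by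
  constructor
  · rintro ⟨v, hv⟩
    have hreal (i) : v.rep ⬝ᵥ (A i).focusVector = 0 := by
      rw [← Projectivization.orthogonal_mk v.rep_nonzero (A i).focusVector_ne_zero, v.mk_rep,
        (A i).mk_focusVector]
      exact hv i
    refine ⟨Complex.ofRealHom ∘ v.rep, fun h => v.rep_nonzero (funext fun k =>
      Complex.ofReal_eq_zero.1 (congrFun h k)), fun i => ?_⟩
    rw [Camera.complexFocus, ← RingHom.map_dotProduct, hreal, map_zero]
  · rintro ⟨w, hw, hw0⟩
    obtain ⟨v, hv, hv0⟩ : ∃ v : Fin 4 → ℝ, v ≠ 0 ∧ ∀ i, v ⬝ᵥ (A i).focusVector = 0 := by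
      by_cases hre : (fun k => (w k).re) = 0
      · refine ⟨fun k => (w k).im, fun him => hw (funext fun k =>
          Complex.ext (congrFun hre k) (congrFun him k)), fun i => ?_⟩
        simpa [dotProduct, Camera.complexFocus] using congrArg Complex.im (hw0 i)
      · refine ⟨_, hre, fun i => ?_⟩
        simpa [dotProduct, Camera.complexFocus] using congrArg Complex.re (hw0 i)
    refine ⟨Projectivization.mk ℝ v hv, fun i => ?_⟩
    rw [← (A i).mk_focusVector, Projectivization.orthogonal_mk]
    exact hv0 i

variable (A) in
/-- The joint images of an arrangement, with the bifocal ideal as the ideal of relations. -/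
def bifocalSystem (hfoci : ∀ i j, i ≠ j → (A i).focus ≠ (A j).focus) :
    TwoViewSystem (Fin n) ℂ (PolyRing n) where
  focus i := (A i).complexFocus
  focus_ne_zero i := (A i).complexFocus_ne_zero
  focus_notMem_span i j hij := Camera.complexFocus_notMem_span (hfoci i j hij)
  relations := focalIdeal A 2
  form := imageForm A
  generic := (aeval (Sum.elim 1 X)).comp (genericJointImage A)
  generic_form i w hw := by
    rw [AlgHom.comp_apply, genericJointImage_imageForm A i hw, map_mul, aeval_X, aeval_rename,
      Sum.elim_comp_inr, aeval_X_left_apply, Sum.elim_inl, Pi.one_apply, one_mul]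
  exchange_mem i j hij _ _ hwi hwj hwi' hwj' :=
    imageForm_exchange_mem_focalIdeal_two (hfoci i j hij) hwi hwj hwi' hwj'

variable {hfoci : ∀ i j, i ≠ j → (A i).focus ≠ (A j).focus} {σ : Finset (Fin n)}

lemma generic_eq_zero_of_mem_focalIdeal {k : ℕ} {F : PolyRing n} (hF : F ∈ focalIdeal A k) :
    (bifocalSystem A hfoci).generic F = 0 := by
  have hker : genericJointImage A F = 0 := focalIdeal_le_ker_genericJointImage A k hF
  rw [bifocalSystem, AlgHom.comp_apply, hker, map_zero]

lemma prod_symbolicMatrix_mem_multilinear (r : Fin 4 ⊕ σ → σ × Fin 3) :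
    ∏ c, symbolicMatrix A σ (r c) c ∈ (bifocalSystem A hfoci).multilinear σ := by
  have hinl (j : Fin 4) : symbolicMatrix A σ (r (.inl j)) (.inl j) =
      C ((A (r (.inl j)).1).complexMat (r (.inl j)).2 j) := rfl
  rw [Fintype.prod_sum_type, Fintype.prod_congr _ _ hinl, ← map_prod, ← smul_eq_C_mul]
  refine Submodule.smul_mem _ _ ?_
  by_cases hdiag : ∀ i, (r (.inr i)).1 = i
  · have hinr (i : σ) :
        symbolicMatrix A σ (r (.inr i)) (.inr i) =
          imageForm A i ((A i).complexMat (r (.inr i)).2) := by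
      rw [imageForm_row]
      simp [symbolicMatrix, hdiag]
    rw [Fintype.prod_congr _ _ hinr]
    exact TwoViewSystem.prod_form_mem_multilinear (S := bifocalSystem A hfoci) fun i =>
      (A i).complexMat_dotProduct_complexFocus _
  · obtain ⟨i, hi⟩ := not_forall.1 hdiag
    rw [Finset.prod_eq_zero (Finset.mem_univ i) (if_neg (Ne.symm hi))]
    exact zero_mem _

lemma det_submatrix_symbolicMatrix_mem_multilinear {k : ℕ} (hσ : σ.card = k)
    (r : Fin (4 + k) → σ × Fin 3) (c : Fin (4 + k) ↪ Fin 4 ⊕ σ) :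
    ((symbolicMatrix A σ).submatrix r c).det ∈ (bifocalSystem A hfoci).multilinear σ := by
  let e : Fin (4 + k) ≃ Fin 4 ⊕ σ := Equiv.ofBijective c
    ((Fintype.bijective_iff_injective_and_card c).2
      ⟨c.injective, by rw [card_sum_coe_eq hσ, Fintype.card_fin]⟩)
  rw [det_apply]
  refine sum_mem fun π _ => ?_
  rw [Units.smul_def, ← Int.cast_smul_eq_zsmul ℂ, ← e.symm.prod_comp]
  refine Submodule.smul_mem _ _ ?_
  convert prod_symbolicMatrix_mem_multilinear (A := A) (hfoci := hfoci) (r ∘ π ∘ e.symm) using 3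
  exact congrArg (symbolicMatrix A σ _) (e.apply_symm_apply _)

theorem minors_le_focalIdeal_two_of_exact {k : ℕ} (hσ : σ.card = k)
    (hex : (bifocalSystem A hfoci).Exact σ) :
    minors (4 + k) (symbolicMatrix A σ) ≤ focalIdeal A 2 := by
  refine Ideal.span_le.2 ?_
  rintro - ⟨r, c, rfl⟩
  exact hex _ (det_submatrix_symbolicMatrix_mem_multilinear hσ r c)
    (generic_eq_zero_of_mem_focalIdeal
      (minors_le_focalIdeal hσ (Ideal.subset_span ⟨r, c, rfl⟩)))

theorem exact_of_not_isCoplanar (h : ¬ IsCoplanar A) :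
    (bifocalSystem A hfoci).Exact Finset.univ := by
  refine TwoViewSystem.exact_of_span_eq_top (Submodule.eq_top_iff'.2 fun x => ?_)
  by_contra hx
  obtain ⟨w, hw, hwx⟩ := exists_dotProduct_eq_zero_and_ne_zero hx
  refine h (isCoplanar_iff_exists_forall_dotProduct_complexFocus_eq_zero.2 ⟨w, ?_, fun i =>
    hw _ (Submodule.subset_span ⟨i, Finset.mem_coe.2 (Finset.mem_univ i), rfl⟩)⟩)
  rintro rfl
  exact hwx (zero_dotProduct x)

theorem focalIdeal_le_focalIdeal_two_of_not_isCoplanar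
    (hfoci : ∀ i j, i ≠ j → (A i).focus ≠ (A j).focus) (h : ¬ IsCoplanar A) :
    focalIdeal A n ≤ focalIdeal A 2 := by
  refine focalIdeal_le_iff.2 fun σ hσ => ?_
  obtain rfl : σ = Finset.univ := Finset.eq_univ_of_card _ (by rw [hσ, Fintype.card_fin])
  exact minors_le_focalIdeal_two_of_exact hσ (exact_of_not_isCoplanar (hfoci := hfoci) h)

variable (A) in
lemma adjoin_imageForm_eq_top :
    Algebra.adjoin ℂ {x | ∃ i w, w ⬝ᵥ (A i).complexFocus = 0 ∧ x = imageForm A i w} = ⊤ := by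
  rw [← top_le_iff, ← adjoin_range_X]
  refine Algebra.adjoin_mono (Set.range_subset_iff.2 fun ⟨i, k⟩ => ?_)
  exact ⟨i, _, (A i).complexMat_dotProduct_complexFocus k, (imageForm_row A i k).symm⟩

theorem prod_X_mul_mem_focalIdeal_two (hfoci : ∀ i j, i ≠ j → (A i).focus ≠ (A j).focus)
    (h : ¬ IsCoplanar A) {F : PolyRing n} (hF : genericJointImage A F = 0) (k : Fin n → Fin 3) :
    (∏ i, X (i, k i)) * F ∈ focalIdeal A 2 := by
  have hprod := TwoViewSystem.prod_mul_mem (S := bifocalSystem A hfoci)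
    (ev := fun t q => (aeval (Sum.elim t q)).comp (genericJointImage A))
    (exact_of_not_isCoplanar h) (adjoin_imageForm_eq_top A) (fun t q i w hw => ?_)
    (fun t q x hx => ?_) (F := F) (fun t q => ?_) (w := fun i => (A i).complexMat (k i))
    fun i => (A i).complexMat_dotProduct_complexFocus _
  · simpa only [bifocalSystem, imageForm_row] using hprod
  · rw [AlgHom.comp_apply, bifocalSystem, genericJointImage_imageForm A i hw, map_mul, aeval_X,
      aeval_rename, Sum.elim_inl, Sum.elim_comp_inr]
    exact congrArg _ (eval_linearForm w q)
  · have hker : genericJointImage A x = 0 := focalIdeal_le_ker_genericJointImage A 2 hx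
    rw [AlgHom.comp_apply, hker, map_zero]
  · rw [AlgHom.comp_apply, hF, map_zero]

theorem multiviewIdeal_eq_colon_of_not_isCoplanar
    (hfoci : ∀ i j, i ≠ j → (A i).focus ≠ (A j).focus) (h : ¬ IsCoplanar A) :
    multiviewIdeal A = (focalIdeal A 2).colon (irrelevantIdeal n : Set (PolyRing n)) := by
  rw [multiviewIdeal_eq_ker]
  ext F
  rw [mem_colon_irrelevantIdeal, RingHom.mem_ker]
  refine ⟨fun hF k => ?_, fun hF => ?_⟩
  · rw [mul_comm]
    exact prod_X_mul_mem_focalIdeal_two hfoci h hF k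
  · have hker : genericJointImage A (F * ∏ i, X (i, 0)) = 0 :=
      focalIdeal_le_ker_genericJointImage A 2 (hF 0)
    rw [map_mul, map_prod] at hker
    exact (mul_eq_zero.1 hker).resolve_right
      (Finset.prod_ne_zero_iff.2 fun i _ => genericJointImage_X_ne_zero A _)

end Bifocal

section Coplanar

section LinearAlgebra

variable {K : Type*} [Field K]

lemma exists_dotProduct_eq_zero_forall_notMem_span_pair {α : Type*} [Finite α] [Infinite K] {m : ℕ}
    (hm : 3 ≤ m) {v : Fin (m + 1) → K} (hv : v ≠ 0) (a b : α → Fin (m + 1) → K) :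
    ∃ w, v ⬝ᵥ w = 0 ∧ ∀ i, w ∉ Submodule.span K {a i, b i} := by
  obtain ⟨w, hw, hN⟩ := exists_mem_forall_notMem (W := LinearMap.ker (dotProductEquiv K _ v))
    (N := fun i => Submodule.span K {a i, b i}) fun i hle => by
    have hpair : Module.finrank K (Submodule.span K {a i, b i}) ≤ 2 := by
      have hrange := finrank_range_le_card (R := K) ![a i, b i]
      rwa [range_cons_cons_empty, Set.finrank, Fintype.card_fin] at hrange
    have hmono := Submodule.finrank_mono hle
    rw [finrank_ker_dotProductEquiv hv] at hmono
    omega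
  exact ⟨w, by simpa using hw, hN⟩

lemma exists_smul_add_smul_eq_smul_add_smul {v a b c d : Fin 4 → K} (hv : v ≠ 0)
    (ha : v ⬝ᵥ a = 0) (hb : v ⬝ᵥ b = 0) (hc : v ⬝ᵥ c = 0) (hd : v ⬝ᵥ d = 0) :
    ∃ t : Fin 4 → K, t ≠ 0 ∧ t 0 • a + t 1 • b = t 2 • c + t 3 • d := by
  have hrow (k : Fin 4) : v ⬝ᵥ ![a, b, -c, -d] k = 0 := by
    fin_cases k
    exacts [ha, hb, (dotProduct_neg _ _).trans (neg_eq_zero.2 hc),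
      (dotProduct_neg _ _).trans (neg_eq_zero.2 hd)]
  have hdet : (Matrix.of ![a, b, -c, -d]).det = 0 :=
    exists_mulVec_eq_zero_iff.1 ⟨v, hv, funext fun k => (dotProduct_comm _ _).trans (hrow k)⟩
  obtain ⟨t, ht, ht0⟩ := exists_vecMul_eq_zero_iff.2 hdet
  refine ⟨t, ht, sub_eq_zero.1 ?_⟩
  rw [← ht0, vecMul_eq_sum, Fin.sum_univ_four]
  change _ = t 0 • a + t 1 • b + t 2 • (-c) + t 3 • (-d)
  module

lemma eq_zero_of_add_smul_mem_span {V : Type*} [AddCommGroup V] [Module K V] {a b c w q : V}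
    {s t u : K} (hab : a ∉ Submodule.span K {b}) (hwab : w ∉ Submodule.span K {a, b})
    (hwac : w ∉ Submodule.span K {a, c}) (ha : q + s • w ∈ Submodule.span K {a})
    (hb : q + t • w ∈ Submodule.span K {b}) (hc : q + u • a ∈ Submodule.span K {c}) : q = 0 := by
  obtain ⟨x, hx⟩ := Submodule.mem_span_singleton.1 ha
  obtain ⟨y, hy⟩ := Submodule.mem_span_singleton.1 hb
  obtain ⟨z, hz⟩ := Submodule.mem_span_singleton.1 hc
  have hst : s - t = 0 := by
    by_contra hne
    refine hwab ((Submodule.smul_mem_iff _ hne).1 (Submodule.mem_span_pair.2 ⟨x, -y, ?_⟩))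
    linear_combination (norm := module) hx - hy
  have hx0 : x = 0 := by
    by_contra hne
    refine hab ((Submodule.smul_mem_iff _ hne).1 (Submodule.mem_span_singleton.2 ⟨y, ?_⟩))
    rw [hx, hy, sub_eq_zero.1 hst]
  rw [hx0, zero_smul] at hx
  have hs : s = 0 := by
    by_contra hne
    refine hwac ((Submodule.smul_mem_iff _ hne).1 (Submodule.mem_span_pair.2 ⟨u, -z, ?_⟩))
    linear_combination (norm := module) hx - hz
  simpa [hs] using hx.symm

end LinearAlgebra

variable {n : ℕ}

/-- The coordinates of the images of points `ω i`, one point for each camera `A i`. -/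
def imagePoint (A : Fin n → Camera) (ω : Fin n → Fin 4 → ℂ) : Fin n × Fin 3 → ℂ :=
  fun x => ((A x.1).complexMat *ᵥ ω x.1) x.2

variable {A : Fin n → Camera} {ω : Fin n → Fin 4 → ℂ}

lemma map_eval_C_mulVec_add_smul_eq_zero_iff (p : Fin n × Fin 3 → ℂ) (hp : p = imagePoint A ω)
    {q : Fin 4 → ℂ} {t : ℂ} {i : Fin n} :
    (A i).complexMat.map ((eval p).comp C) *ᵥ q + t • (fun l => eval p (X (i, l))) = 0 ↔
      q + t • ω i ∈ Submodule.span ℂ {(A i).complexFocus} := by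
  have hmap : (A i).complexMat.map ((eval p).comp C) = (A i).complexMat :=
    Matrix.ext fun _ _ => eval_C _
  have himage : (fun l => eval p (X (i, l))) = (A i).complexMat *ᵥ ω i :=
    funext fun l => by rw [eval_X, hp]; rfl
  rw [hmap, himage, ← mulVec_smul, ← mulVec_add, Camera.complexMat_mulVec_eq_zero_iff]

theorem focalIdeal_two_le_ker_eval_imagePoint {v : Fin 4 → ℂ} (hv : v ≠ 0)
    (hf : ∀ i, v ⬝ᵥ (A i).complexFocus = 0) (hω : ∀ i, v ⬝ᵥ ω i = 0) :
    focalIdeal A 2 ≤ RingHom.ker (eval (imagePoint A ω)) := by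
  refine focalIdeal_le_ker_of_forall_exists _ fun σ hσ => ?_
  obtain ⟨i, j, hij, rfl⟩ := Finset.card_eq_two.1 hσ
  -- The line through the focus `i` and `ω i` meets the line through the focus `j` and `ω j`.
  obtain ⟨t, ht, hmeet⟩ := exists_smul_add_smul_eq_smul_add_smul hv (hf i) (hω i) (hf j) (hω j)
  refine ⟨t 0 • (A i).complexFocus + t 1 • ω i, fun k => if k = i then -t 1 else -t 3, ?_, ?_⟩
  · by_contra! hzero
    obtain ⟨hq, hτ⟩ := hzero
    have h1 : t 1 = 0 := by simpa using hτ i (by simp)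
    have h3 : t 3 = 0 := by simpa [hij.symm] using hτ j (by simp)
    have h2 : t 2 • (A j).complexFocus = 0 := by simpa [hq, h3] using hmeet.symm
    have h0 : t 0 • (A i).complexFocus = 0 := by simpa [h1] using hq
    refine ht (funext fun k => ?_)
    fin_cases k
    exacts [(smul_eq_zero.1 h0).resolve_right (A i).complexFocus_ne_zero, h1,
      (smul_eq_zero.1 h2).resolve_right (A j).complexFocus_ne_zero, h3]
  · intro k hk
    rw [map_eval_C_mulVec_add_smul_eq_zero_iff _ rfl, Submodule.mem_span_singleton]
    rcases Finset.mem_insert.1 hk with rfl | hkj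
    · exact ⟨t 0, by simp⟩
    · rw [Finset.mem_singleton.1 hkj, hmeet]
      exact ⟨t 2, by simp [hij.symm]⟩

theorem exists_mem_focalIdeal_eval_imagePoint_ne_zero
    (hω : ∀ i, ω i ∉ Submodule.span ℂ {(A i).complexFocus})
    (h : ∀ (q : Fin 4 → ℂ) (τ : Fin n → ℂ),
      (∀ i, q + τ i • ω i ∈ Submodule.span ℂ {(A i).complexFocus}) → q = 0) :
    ∃ g ∈ focalIdeal A n, eval (imagePoint A ω) g ≠ 0 := by
  have hcard : (Finset.univ : Finset (Fin n)).card = n := Finset.card_fin n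
  obtain ⟨g, hg, hg0⟩ := exists_mem_minors_map_ne_zero (eval (imagePoint A ω))
    (card_sum_coe_eq hcard) (M := symbolicMatrix A Finset.univ) fun v hv => by
    rw [symbolicMatrix_map_mulVec_eq_zero_iff] at hv
    simp only [map_eval_C_mulVec_add_smul_eq_zero_iff _ rfl] at hv
    have hq := h (v ∘ .inl) (fun i => v (.inr ⟨i, Finset.mem_univ i⟩)) fun i => hv ⟨i, _⟩
    ext (j | i)
    · exact congrFun hq j
    · have hvi := hv i
      rw [hq, zero_add] at hvi
      by_contra hne
      exact hω i ((Submodule.smul_mem_iff _ hne).1 hvi)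
  exact ⟨g, minors_le_focalIdeal hcard hg, hg0⟩

/-- The idea: let the cameras `i₀` and `i₁` both see one generic point `w` of the plane, which
then has to be the scene point, and let all others see the focus of `i₀`. -/
lemma exists_notMem_span_complexFocus_of_isCoplanar (hn : 3 ≤ n)
    (hfoci : ∀ i j, i ≠ j → (A i).focus ≠ (A j).focus) {v : Fin 4 → ℂ} (hv : v ≠ 0)
    (hf : ∀ i, v ⬝ᵥ (A i).complexFocus = 0) :
    ∃ ω : Fin n → Fin 4 → ℂ, (∀ i, v ⬝ᵥ ω i = 0) ∧
      (∀ i, ω i ∉ Submodule.span ℂ {(A i).complexFocus}) ∧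
      ∀ (q : Fin 4 → ℂ) (τ : Fin n → ℂ),
        (∀ i, q + τ i • ω i ∈ Submodule.span ℂ {(A i).complexFocus}) → q = 0 := by
  obtain ⟨i₀, i₁, i₂, h01, h02, h12⟩ : ∃ i₀ i₁ i₂ : Fin n, i₀ ≠ i₁ ∧ i₀ ≠ i₂ ∧ i₁ ≠ i₂ :=
    ⟨⟨0, by omega⟩, ⟨1, by omega⟩, ⟨2, by omega⟩, by simp⟩
  obtain ⟨w, hvw, hw⟩ := exists_dotProduct_eq_zero_forall_notMem_span_pair le_rfl hv
    (fun _ => (A i₀).complexFocus) ![(A i₁).complexFocus, (A i₂).complexFocus]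
  have hw1 := hw 0
  refine ⟨fun i => if i = i₀ ∨ i = i₁ then w else (A i₀).complexFocus, fun i => ?_, fun i => ?_,
    fun q τ hq => ?_⟩
  · dsimp only
    split_ifs
    exacts [hvw, hf i₀]
  · dsimp only
    split_ifs with hi
    · refine fun hmem => hw1 (Submodule.span_mono ?_ hmem)
      rcases hi with rfl | rfl <;> simp
    · exact Camera.complexFocus_notMem_span (hfoci i₀ i fun h => hi (.inl h.symm))
  · exact eq_zero_of_add_smul_mem_span (Camera.complexFocus_notMem_span (hfoci i₀ i₁ h01)) hw1
      (hw 1) (by simpa using hq i₀) (by simpa using hq i₁)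
      (by simpa [h02.symm, h12.symm] using hq i₂)

theorem not_focalIdeal_le_colon_of_isCoplanar (hn : 3 ≤ n)
    (hfoci : ∀ i j, i ≠ j → (A i).focus ≠ (A j).focus) (h : IsCoplanar A) :
    ¬ focalIdeal A n ≤ (focalIdeal A 2).colon (irrelevantIdeal n : Set (PolyRing n)) := by
  obtain ⟨v, hv, hf⟩ := isCoplanar_iff_exists_forall_dotProduct_complexFocus_eq_zero.1 h
  obtain ⟨ω, hvω, hω, hq⟩ := exists_notMem_span_complexFocus_of_isCoplanar hn hfoci hv hf
  obtain ⟨g, hg, hg0⟩ := exists_mem_focalIdeal_eval_imagePoint_ne_zero hω hq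
  have hcoord (i) : ∃ k, imagePoint A ω (i, k) ≠ 0 :=
    Function.ne_iff.1 fun h0 => hω i ((A i).complexMat_mulVec_eq_zero_iff.1 h0)
  choose k hk using hcoord
  intro hle
  have hmul := focalIdeal_two_le_ker_eval_imagePoint hv hf hvω
    (mem_colon_irrelevantIdeal.1 (hle hg) k)
  rw [RingHom.mem_ker, map_mul, map_prod] at hmul
  refine mul_ne_zero hg0 (Finset.prod_ne_zero_iff.2 fun i _ => ?_) hmul
  rw [eval_X]
  exact hk i

end Coplanar

end Multiview

end

open Multiview in
theorem mainTheorem2_general {n : ℕ} (hn : 3 ≤ n) (A : Fin n → Camera)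
    (hfoci : ∀ i j, i ≠ j → (A i).focus ≠ (A j).focus) :
    [¬ IsCoplanar A,
      focalIdeal A n ≤ focalIdeal A 2,
      multiviewIdeal A =
        (focalIdeal A 2).colon (irrelevantIdeal n : Set (PolyRing n))].TFAE := by
  have hcolon : focalIdeal A n ≤ (focalIdeal A 2).colon (irrelevantIdeal n : Set (PolyRing n)) →
      ¬ IsCoplanar A := fun hle h => not_focalIdeal_le_colon_of_isCoplanar hn hfoci h hle
  tfae_have 1 → 2 := focalIdeal_le_focalIdeal_two_of_not_isCoplanar hfoci
  tfae_have 1 → 3 := multiviewIdeal_eq_colon_of_not_isCoplanar hfoci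
  tfae_have 2 → 1 := fun hle => hcolon (hle.trans Ideal.le_colon)
  tfae_have 3 → 1 := fun heq => hcolon (heq ▸ focalIdeal_le_multiviewIdeal n)
  tfae_finish

theorem mainTheorem2 {n : ℕ} (hn : 4 ≤ n) (A : Fin n → Multiview.Camera)
    (hfoci : ∀ i j, i ≠ j → (A i).focus ≠ (A j).focus) :
    [¬ Multiview.IsCoplanar A,
      Multiview.focalIdeal A n ≤ Multiview.focalIdeal A 2,
      Multiview.multiviewIdeal A =
        (Multiview.focalIdeal A 2).colon
          (Multiview.irrelevantIdeal n : Set (Multiview.PolyRing n))].TFAE :=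
  mainTheorem2_general (by omega) A hfoci
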